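/- Notation. For $\lambda=(p,\theta)\in\mathbb R^2$ let $|\lambda|=(p^2+\theta^2)^{1/2}$ and let $\mathbf e_\lambda(x)=2^{1/4}\exp\left(-\pi(x-p)^2+2\pi i\theta x\right)$, $x\in\mathbb R$, be the Gabor function; $\langle f|g\rangle=\int f\bar g$ is the scalar product of $L_2(\mathbb R)$. For $\delta>0$ put $$\|f\|_\delta=\left(\int_{\mathbb R^2}\left(|\lambda|^\delta+1\right)^2\left|\langle f|\mathbf e_\lambda\rangle\right|^2d\lambda\right)^{1/2},\qquad H^\delta=\{f\in L_2(\mathbb R):\|f\|_\delta<\infty\},$$ so that $H^\delta$ is the modulation space $M^{w}_{2,2}$ with the weight $w(\lambda)=|\lambda|^\delta+1$. Let $H=\bigcup_{\delta>1}H^\delta$ with its locally convex inductive limit topology (a linear functional on $H$ is continuous iff its restriction to every $H^\delta$, $\delta>1$, is continuous for $\|\cdot\|_\delta$). Let $\Lambda=\mathbb Z\times\mathbb Z$, $\sharp=(1/2,1/2)$, $\Lambda^\sharp=\Lambda\cup\{\sharp\}$, $\Theta(z)=2^{1/4}\sum_{q\in\mathbb Z}\exp(2\pi i qz-\pi q^2)$,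 and $$\gamma^\sharp(f)=\frac1{i\,\Theta(0)}\sum_{q\in\mathbb Z}(-1)^q f(q+1/2).$$ Theorem (relaxed Gabor expansion). Every $f\in H$ has a continuous representative, for which the series defining $\gamma^\sharp(f)$ converges absolutely, and $\gamma^\sharp$ is a continuous linear functional on $H$. There exists a family of continuous linear functionals $\gamma^\lambda$, $\lambda\in\Lambda$, on $H$ such that, together with $\gamma^\sharp$: (i) for every $f\in H$, $$f=\sum_{\lambda\in\Lambda^\sharp}\gamma^\lambda(f)\,\mathbf e_\lambda,$$ where the series converges (unconditionally) in $L_2(\mathbb R)$; (ii) for every $\delta>1$ there exists a constant $C_\delta$ such that for all $f\in H^\delta$ $$\sum_{\lambda\in\Lambda^\sharp}\left|\gamma^\lambda(f)\right|^2\le C_\delta\|f\|_\delta^2 .$$ -/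

import Mathlib

open MeasureTheory Filter Topology

noncomputable section

namespace RelaxedGabor

/-- The Hilbert space `L₂(ℝ)` of complex-valued functions. -/
abbrev L2 : Type := Lp ℂ 2 (volume : Measure ℝ)

/-- The phase plane `Φ = ℝ × ℝ'`, with points `(p, θ)`, and its Lebesgue measure. -/
abbrev Phase : Type := ℝ × ℝ

/-- The Euclidean length `|(p, θ)|`. (The norm of `ℝ × ℝ` is the sup norm.) -/
def euclid (l : Phase) : ℝ := √(l.1 ^ 2 + l.2 ^ 2)

/-- The Gabor function `e_l(x) = 2^{1/4} exp(-π (x - p)² + 2 π i θ x)`, `l = (p, θ)`. -/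
def gaborFun (l : Phase) (x : ℝ) : ℂ :=
  ((2 : ℝ) ^ (1 / 4 : ℝ) : ℝ) *
    Complex.exp (-Real.pi * ((x : ℂ) - l.1) ^ 2 + 2 * Real.pi * Complex.I * l.2 * x)

theorem continuous_gaborFun_uncurry :
    Continuous (fun z : Phase × ℝ => gaborFun z.1 z.2) := by
  unfold gaborFun
  fun_prop

theorem memLp_gaborFun (l : Phase) : MemLp (gaborFun l) 2 (volume : Measure ℝ) := by
  have hc : Continuous (gaborFun l) := by unfold gaborFun; fun_prop
  rw [memLp_two_iff_integrable_sq_norm hc.aestronglyMeasurable]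
  have h : ∀ x, ‖gaborFun l x‖ ^ 2 =
      ((2 : ℝ) ^ (1 / 4 : ℝ)) ^ 2 * Real.exp (-(2 * Real.pi) * (x - l.1) ^ 2) := by
    intro x
    have e : (-Real.pi * ((x : ℂ) - l.1) ^ 2 + 2 * Real.pi * Complex.I * l.2 * x) =
        ((-Real.pi * (x - l.1) ^ 2 : ℝ) : ℂ) + ((2 * Real.pi * l.2 * x : ℝ) : ℂ) * Complex.I := by
      push_cast; ring
    rw [gaborFun, e, norm_mul, Complex.norm_exp, Complex.norm_real, mul_pow, Real.norm_eq_abs,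
      sq_abs, ← Real.exp_nat_mul]
    congr 2
    have e1 : ((-Real.pi * (x - l.1) ^ 2 : ℝ) + ((2 * Real.pi * l.2 * x : ℝ) : ℂ) * Complex.I).re
        = -Real.pi * (x - l.1) ^ 2 := by
      rw [Complex.add_re, Complex.ofReal_re, Complex.re_ofReal_mul, Complex.I_re]; ring
    rw [e1]
    push_cast
    ring
  simp_rw [h]
  exact ((integrable_exp_neg_mul_sq (by positivity : 0 < 2 * Real.pi)).comp_sub_right
    l.1).const_mul _

/-- The Gabor function `e_l` as an element of `L₂(ℝ)`. -/
def gaborState (l : Phase) : L2 := (memLp_gaborFun l).toLp (gaborFun l)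

/-- The Gabor transform `l ↦ ⟨f | e_l⟩ = ∫ f(x) conj(e_l(x)) dx`. (Mathlib's inner product is
conjugate-linear in its first argument.) -/
def gaborTransform (f : L2) (l : Phase) : ℂ := inner ℂ (gaborState l) f

theorem gaborTransform_eq_integral (f : L2) (l : Phase) :
    gaborTransform f l = ∫ x, f x * starRingEnd ℂ (gaborFun l x) := by
  rw [gaborTransform, L2.inner_def]
  refine integral_congr_ae ?_
  filter_upwards [(memLp_gaborFun l).coeFn_toLp] with x hx
  rw [gaborState, hx]
  simp

theorem stronglyMeasurable_gaborTransform (f : L2) :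
    StronglyMeasurable (gaborTransform f) := by
  have h : gaborTransform f = fun l => ∫ x, f x * starRingEnd ℂ (gaborFun l x) :=
    funext (gaborTransform_eq_integral f)
  rw [h]
  refine StronglyMeasurable.integral_prod_right
    (f := fun l x => f x * starRingEnd ℂ (gaborFun l x)) ?_
  have h1 : StronglyMeasurable (fun z : Phase × ℝ => f z.2) :=
    (Lp.stronglyMeasurable f).comp_measurable measurable_snd
  have h2 : StronglyMeasurable (fun z : Phase × ℝ => starRingEnd ℂ (gaborFun z.1 z.2)) :=
    (Complex.continuous_conj.comp continuous_gaborFun_uncurry).stronglyMeasurable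
  exact h1.mul h2

/-- The weight `w_δ(l) = |l|^δ + 1` on the phase plane. -/
def weight (δ : ℝ) (l : Phase) : ℝ := euclid l ^ δ + 1

/-- The condition `∫ w_δ(l)² |⟨f | e_l⟩|² dl < ∞`: membership in the modulation space
`M^w_{2,2}` for the weight `w = w_δ`. -/
def FiniteGaborNorm (δ : ℝ) (f : L2) : Prop :=
  Integrable (fun l : Phase => weight δ l ^ 2 * ‖gaborTransform f l‖ ^ 2)

/-- The norm `‖f‖_δ = (∫ w_δ(l)² |⟨f | e_l⟩|² dl)^{1/2}` (meaningful if `FiniteGaborNorm δ f`). -/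
def gaborNorm (δ : ℝ) (f : L2) : ℝ :=
  √(∫ l : Phase, weight δ l ^ 2 * ‖gaborTransform f l‖ ^ 2)

theorem measurable_weight (δ : ℝ) : Measurable (weight δ) := by
  unfold weight euclid
  fun_prop

theorem aestronglyMeasurable_weighted (δ : ℝ) (f : L2) :
    AEStronglyMeasurable (fun l : Phase => (weight δ l : ℂ) * gaborTransform f l) volume :=
  ((Complex.measurable_ofReal.comp (measurable_weight δ)).stronglyMeasurable.mul
    (stronglyMeasurable_gaborTransform f)).aestronglyMeasurable

theorem finiteGaborNorm_iff (δ : ℝ) (f : L2) :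
    FiniteGaborNorm δ f ↔
      MemLp (fun l : Phase => (weight δ l : ℂ) * gaborTransform f l) 2 volume := by
  rw [memLp_two_iff_integrable_sq_norm (aestronglyMeasurable_weighted δ f), FiniteGaborNorm]
  simp [mul_pow]

/-- The space `H^δ` of all `f ∈ L₂(ℝ)` with `‖f‖_δ < ∞`. -/
def gaborSpace (δ : ℝ) : Submodule ℂ L2 where
  carrier := {f | FiniteGaborNorm δ f}
  zero_mem' := by
    simp [FiniteGaborNorm, gaborTransform]
  add_mem' := by
    intro f g hf hg
    simp only [Set.mem_ofPred_eq, finiteGaborNorm_iff] at *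
    convert hf.add hg using 1
    ext l
    simp [gaborTransform, inner_add_right, mul_add]
  smul_mem' := by
    intro c f hf
    simp only [Set.mem_ofPred_eq, finiteGaborNorm_iff] at *
    convert hf.const_mul c using 1
    ext l
    simp [gaborTransform, inner_smul_right]
    ring

/-- The map `f ↦ w_δ · ⟨f | e_•⟩` from `H^δ` to `L₂(Φ)`. -/
def weightedTransform (δ : ℝ) : gaborSpace δ →ₗ[ℂ] Lp ℂ 2 (volume : Measure Phase) where
  toFun f := ((finiteGaborNorm_iff δ f).1 f.2).toLp
    (fun l : Phase => (weight δ l : ℂ) * gaborTransform f l)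
  map_add' f g := by
    rw [← MemLp.toLp_add]
    congr 1
    ext l
    simp [gaborTransform, inner_add_right, mul_add]
  map_smul' c f := by
    rw [RingHom.id_apply, ← MemLp.toLp_const_smul]
    congr 1
    ext l
    simp [gaborTransform, inner_smul_right]
    ring

/-- `‖f‖_δ` is the norm pulled back along `weightedTransform δ`. -/
theorem norm_weightedTransform (δ : ℝ) (f : gaborSpace δ) :
    ‖weightedTransform δ f‖ = gaborNorm δ f := by
  have h := (finiteGaborNorm_iff δ f).1 f.2
  rw [gaborNorm, eq_comm, Real.sqrt_eq_iff_eq_sq (by positivity) (norm_nonneg _),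
    ← real_inner_self_eq_norm_sq, L2.inner_def]
  refine integral_congr_ae ?_
  filter_upwards [h.coeFn_toLp] with l hl
  change _ = inner ℝ ((h.toLp _ : Lp ℂ 2 (volume : Measure Phase)) l)
    ((h.toLp _ : Lp ℂ 2 (volume : Measure Phase)) l)
  rw [hl, real_inner_self_eq_norm_sq]
  simp [mul_pow]

/-- The topology of `H^δ` given by the norm `‖·‖_δ` (see `norm_weightedTransform`). -/
abbrev gaborSpaceTopology (δ : ℝ) : TopologicalSpace (gaborSpace δ) :=
  TopologicalSpace.induced (weightedTransform δ) inferInstance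

theorem gaborSpace_anti {δ δ' : ℝ} (h0 : 0 ≤ δ) (h : δ ≤ δ') :
    gaborSpace δ' ≤ gaborSpace δ := by
  intro f hf
  change FiniteGaborNorm δ' f at hf
  change FiniteGaborNorm δ f
  rw [finiteGaborNorm_iff] at *
  refine (hf.norm.const_mul 2).mono (aestronglyMeasurable_weighted δ f) (ae_of_all _ fun l => ?_)
  have hl : 0 ≤ euclid l := Real.sqrt_nonneg _
  have ha : 0 ≤ euclid l ^ δ := Real.rpow_nonneg hl _
  have hb : 0 ≤ euclid l ^ δ' := Real.rpow_nonneg hl _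
  have key : weight δ l ≤ 2 * weight δ' l := by
    unfold weight
    rcases le_total 1 (euclid l) with h1 | h1
    · have := Real.rpow_le_rpow_of_exponent_le h1 h
      linarith
    · have := Real.rpow_le_one hl h1 h0
      linarith
  have w0 : 0 ≤ weight δ l := by unfold weight; linarith
  have w1 : 0 ≤ weight δ' l := by unfold weight; linarith
  simp only [norm_mul, Complex.norm_real, Real.norm_eq_abs, abs_of_nonneg w0, abs_of_nonneg w1,
    Nat.abs_ofNat, abs_norm]
  calc weight δ l * ‖gaborTransform f l‖ ≤ (2 * weight δ' l) * ‖gaborTransform f l‖ := by gcongr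
    _ = _ := by ring

/-- The space `H = ⋃_{δ > 1} H^δ`. -/
def gaborH : Submodule ℂ L2 where
  carrier := {f | ∃ δ : ℝ, 1 < δ ∧ f ∈ gaborSpace δ}
  zero_mem' := ⟨2, by norm_num, zero_mem _⟩
  add_mem' := by
    rintro f g ⟨δ, hδ, hf⟩ ⟨δ', hδ', hg⟩
    have hm : 1 < min δ δ' := lt_min hδ hδ'
    exact ⟨min δ δ', hm, add_mem (gaborSpace_anti (by linarith) (min_le_left _ _) hf)
      (gaborSpace_anti (by linarith) (min_le_right _ _) hg)⟩
  smul_mem' := by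
    rintro c f ⟨δ, hδ, hf⟩
    exact ⟨δ, hδ, Submodule.smul_mem _ c hf⟩

theorem gaborSpace_le_gaborH {δ : ℝ} (hδ : 1 < δ) : gaborSpace δ ≤ gaborH :=
  fun _ hf => ⟨δ, hδ, hf⟩

/-- The locally convex inductive limit topology on `H = ⋃_{δ > 1} H^δ`: the finest locally convex
vector space topology for which all the inclusions `H^δ → H`, `δ > 1`, are continuous.
(It is not the topology that `H` inherits from `L₂(ℝ)`.) -/
abbrev gaborHTopology : TopologicalSpace gaborH :=
  sInf {t : TopologicalSpace gaborH |
    @IsTopologicalAddGroup gaborH t _ ∧ @ContinuousSMul ℂ gaborH _ _ t ∧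
    @LocallyConvexSpace ℝ gaborH _ _ _ _ t ∧
    ∀ (δ : ℝ) (hδ : 1 < δ), Continuous[gaborSpaceTopology δ, t]
      (Submodule.inclusion (gaborSpace_le_gaborH hδ))}

/-- Continuity of a linear functional on `H`. -/
def IsContinuousFunctional (φ : gaborH →ₗ[ℂ] ℂ) : Prop :=
  @Continuous gaborH ℂ gaborHTopology _ φ

/-- The lattice `Λ = ℤ × ℤ` in the phase plane; its cells have area `1`. -/
def lattice : Set Phase := Set.range fun n : ℤ × ℤ => ((n.1 : ℝ), (n.2 : ℝ))

/-- The sharp point `♯ = (1/2, 1/2)`. -/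
def sharp : Phase := (1 / 2, 1 / 2)

/-- The relaxed lattice `Λ ∪ {♯}`. -/
def relaxedLattice : Set Phase := lattice ∪ {sharp}

theorem sharp_mem_relaxedLattice : sharp ∈ relaxedLattice := Or.inr rfl

/-- The function `Θ(z) = 2^{1/4} ∑_q exp(2 π i q z - π q²)`. -/
def Theta (z : ℂ) : ℂ := ((2 : ℝ) ^ (1 / 4 : ℝ) : ℝ) * jacobiTheta₂ z Complex.I

/-- `s` is the value at `f ∈ L₂(ℝ)` of the sharp Poisson functional
`γ^♯(f) = (i Θ(0))⁻¹ ∑_q (-1)^q f(q + 1/2)`: the class `f` has a continuous representative,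
and for it the series converges and gives `s`. -/
def IsSharpPoisson (f : L2) (s : ℂ) : Prop :=
  ∃ g : ℝ → ℂ, Continuous g ∧ f =ᵐ[volume] g ∧
    HasSum (fun q : ℤ => 1 / (Complex.I * Theta 0) * ((-1 : ℂ) ^ q * g (q + 1 / 2))) s

end RelaxedGabor

end

noncomputable section

namespace RelaxedGabor

/-! The Zak transform turns the expansion into a Fourier series. It is isometric from `L₂(ℝ)` to
`L₂` of the unit square, and it sends `e_λ` with `λ ∈ Λ` to a character times `Z e_0`
(`zak_gaborFun_latticePoint`). Expanding `f` in the lattice functions alone would therefore mean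
expanding `Zf / Z e_0` in characters. The obstacle is that `Z e_0`, a Jacobi theta function up to an
exponential factor, has a simple zero at the centre `(1/2, 1/2)` of the square, and the inverse of a
simple zero just fails to be square integrable in the plane.

The extra point `♯` removes this obstacle. Since `Z e_♯` takes the value `i Θ(0) ≠ 0` at the centre
(`zak_gaborFun_sharp_centre`), subtracting `γ^♯(f) e_♯` with `γ^♯(f) = Zf(centre) / (i Θ(0))` makes
the numerator vanish there. The lattice functionals are the Fourier coefficients of the quotient `Q
= Z(f - γ^♯(f) e_♯) / Z e_0`.

What remains is `Q ∈ L₂`. Write `f = ∫ ⟨f|e_l⟩ e_l dl` (`ae_eq_synthesis`). The functions `Z e_l`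
are uniformly bounded, and Lipschitz at the centre with constant `O(1 + |l|)`; interpolation gives
Hölder order `α` with constant `O((1 + |l|)^α)`. For `f ∈ H^δ` and `0 < α < δ - 1`, Cauchy–Schwarz
makes `⟨f|e_l⟩ (1 + |l|)^α` integrable, so `Zf` is Hölder of order `α` at the centre. With the lower
bound `|Z e_0(w)| ≥ c |w - centre|` (`exists_zak_gaussian_ge`) this gives `Q = O(|w - centre|^(α -
1))`, which is square integrable for `α > 0`.

Parseval for `Q` yields the coefficient bound. Boundedness of `Z e_0` and the isometry of `Z` carry
the `L₂` convergence of the Fourier series of `Q` back to the Gabor series. Every function involved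
has absolutely convergent sums over the cosets of `ℤ` (`IsWiener`), so Zak transforms are always
pointwise sums. -/

/-! ### Zak transforms and uniform bounds for Gabor functions -/

/-- The terms of the Zak transform `Zg(y, ξ) = ∑_q g(y + q) exp(-2 π i q ξ)`. -/
def zakTerm (g : ℝ → ℂ) (w : ℝ × ℝ) (q : ℤ) : ℂ :=
  g (w.1 + q) * Complex.exp (-(2 * Real.pi * Complex.I * q * w.2))

/-- The Zak transform of `g`, as an honest function on the plane. -/
def zak (g : ℝ → ℂ) (w : ℝ × ℝ) : ℂ := ∑' q : ℤ, zakTerm g w q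

theorem norm_exp_neg_two_pi_I (q : ℤ) (t : ℝ) :
    ‖Complex.exp (-(2 * Real.pi * Complex.I * q * t))‖ = 1 := by
  have : (-(2 * Real.pi * Complex.I * q * t) : ℂ) = ((-(2 * Real.pi * q * t) : ℝ) : ℂ) *
      Complex.I := by push_cast; ring
  rw [this, Complex.norm_exp_ofReal_mul_I]

theorem norm_zakTerm (g : ℝ → ℂ) (w : ℝ × ℝ) (q : ℤ) : ‖zakTerm g w q‖ = ‖g (w.1 + q)‖ := by
  rw [zakTerm, norm_mul, norm_exp_neg_two_pi_I, mul_one]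

theorem summable_exp_neg_abs_int : Summable fun q : ℤ => Real.exp (-|(q : ℝ)|) := by
  have h : Summable fun n : ℕ => Real.exp (-(n : ℝ)) := Real.summable_exp_neg_nat
  refine Summable.of_nat_of_neg ?_ ?_ <;> simpa using h

/-- Replacing `t` by its integer part moves each point by at most `1`, which costs a factor `e`, and
then only relabels the sum over `ℤ`. -/
theorem exists_bound_exp_neg_abs : ∃ M : ℝ, 0 < M ∧ ∀ t : ℝ,
    Summable (fun q : ℤ => Real.exp (-|t + q|)) ∧ ∑' q : ℤ, Real.exp (-|t + q|) ≤ M := by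
  have key : ∀ (t : ℝ) (q : ℤ), Real.exp (-|t + q|) ≤
      Real.exp 1 * Real.exp (-|((Equiv.addLeft ⌊t⌋ q : ℤ) : ℝ)|) := by
    intro t q
    rw [← Real.exp_add, Real.exp_le_exp, Equiv.coe_addLeft]
    push_cast
    have h1 := Int.floor_le t
    have h2 := Int.lt_floor_add_one t
    have h3 := abs_sub_abs_le_abs_sub ((⌊t⌋ : ℝ) + q) (t + q)
    have h4 : |(⌊t⌋ : ℝ) + q - (t + q)| ≤ 1 := by rw [abs_le]; constructor <;> linarith
    linarith
  have hs : ∀ t : ℝ, Summable fun q : ℤ =>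
      Real.exp 1 * Real.exp (-|((Equiv.addLeft ⌊t⌋ q : ℤ) : ℝ)|) := fun t =>
    (((Equiv.addLeft ⌊t⌋).summable_iff (f := fun q : ℤ => Real.exp (-|(q : ℝ)|))).2
      summable_exp_neg_abs_int).mul_left _
  have hs' : ∀ t : ℝ, Summable (fun q : ℤ => Real.exp (-|t + q|)) := fun t =>
    Summable.of_nonneg_of_le (fun q => (Real.exp_pos _).le) (key t) (hs t)
  refine ⟨Real.exp 1 * ∑' q : ℤ, Real.exp (-|(q : ℝ)|), ?_, fun t => ⟨hs' t, ?_⟩⟩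
  · exact mul_pos (Real.exp_pos _)
      (summable_exp_neg_abs_int.tsum_pos (fun _ => (Real.exp_pos _).le) 0 (Real.exp_pos _))
  · refine ((hs' t).tsum_le_tsum (key t) (hs t)).trans_eq ?_
    rw [tsum_mul_left,
      (Equiv.addLeft ⌊t⌋).tsum_eq (fun q : ℤ => Real.exp (-|(q : ℝ)|))]

/-- Absorbs the linear factor produced by differentiating the exponent of a Gabor function. It rests
on `1 + |u| ≤ exp |u|` and `2|u| ≤ 1 + u² ≤ 1 + π u²`. -/
theorem one_add_abs_mul_gaussian_le (u : ℝ) :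
    (1 + |u|) * Real.exp (-Real.pi * u ^ 2) ≤ Real.exp 1 * Real.exp (-|u|) := by
  have h1 : 1 + |u| ≤ Real.exp |u| := by
    have := Real.add_one_le_exp |u|; linarith
  calc (1 + |u|) * Real.exp (-Real.pi * u ^ 2)
      ≤ Real.exp |u| * Real.exp (-Real.pi * u ^ 2) := by gcongr
    _ ≤ Real.exp 1 * Real.exp (-|u|) := by
      rw [← Real.exp_add, ← Real.exp_add, Real.exp_le_exp]
      have h3 := Real.pi_gt_three
      have h4 := sq_abs u
      nlinarith [sq_nonneg (|u| - 1), sq_nonneg u]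

/-- The exponent of the terms of the Zak transform of a Gabor function. -/
def zakExponent (l w : ℝ × ℝ) (q : ℤ) : ℂ :=
  ((-Real.pi * (w.1 + q - l.1) ^ 2 : ℝ) : ℂ) +
    ((2 * Real.pi * (l.2 * (w.1 + q) - q * w.2) : ℝ) : ℂ) * Complex.I

theorem zakTerm_gaborFun (l w : ℝ × ℝ) (q : ℤ) :
    zakTerm (gaborFun l) w q =
      ((2 : ℝ) ^ (1 / 4 : ℝ) : ℝ) * Complex.exp (zakExponent l w q) := by
  rw [zakTerm, gaborFun, mul_assoc, ← Complex.exp_add, zakExponent]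
  congr 2
  push_cast
  ring

theorem re_zakExponent (l w : ℝ × ℝ) (q : ℤ) :
    (zakExponent l w q).re = -Real.pi * (w.1 + q - l.1) ^ 2 := by
  rw [zakExponent, Complex.add_re, Complex.ofReal_re, Complex.re_ofReal_mul, Complex.I_re]
  ring

theorem norm_gaborFun (l : ℝ × ℝ) (x : ℝ) :
    ‖gaborFun l x‖ = (2 : ℝ) ^ (1 / 4 : ℝ) * Real.exp (-Real.pi * (x - l.1) ^ 2) := by
  have h := zakTerm_gaborFun l (x, 0) 0
  have h2 := norm_zakTerm (gaborFun l) (x, 0) 0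
  simp only [Int.cast_zero, add_zero] at h2
  rw [← h2, h, norm_mul, Complex.norm_exp, re_zakExponent, Complex.norm_real, Real.norm_eq_abs,
    abs_of_pos (by positivity)]
  simp

theorem rpow_quarter_le : (2 : ℝ) ^ (1 / 4 : ℝ) ≤ 2 :=
  Real.rpow_le_self_of_one_le (by norm_num) (by norm_num)

theorem norm_gaborFun_le (l : ℝ × ℝ) (x : ℝ) :
    ‖gaborFun l x‖ ≤ 2 * Real.exp 1 * Real.exp (-|x - l.1|) := by
  rw [norm_gaborFun, mul_assoc]
  refine mul_le_mul rpow_quarter_le ?_ (Real.exp_pos _).le (by norm_num)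
  refine le_trans ?_ (one_add_abs_mul_gaussian_le (x - l.1))
  exact le_mul_of_one_le_left (Real.exp_pos _).le (by simp)

/-- A continuous function whose sums over the cosets of `ℤ` are bounded by `M`. -/
structure IsWiener (g : ℝ → ℂ) (M : ℝ) : Prop where
  continuous : Continuous g
  summable : ∀ y : ℝ, Summable fun q : ℤ => ‖g (y + q)‖
  tsum_le : ∀ y : ℝ, ∑' q : ℤ, ‖g (y + q)‖ ≤ M

/-- Modulation does not change absolute values, and translation is covered by the uniformity in
`exists_bound_exp_neg_abs`. The independence of `M` from `l` is what allows integration over the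
phase plane later. -/
theorem exists_isWiener_gaborFun : ∃ M : ℝ, 0 < M ∧ ∀ l, IsWiener (gaborFun l) M := by
  obtain ⟨M, hM, h⟩ := exists_bound_exp_neg_abs
  refine ⟨2 * Real.exp 1 * M, by positivity, fun l => ?_⟩
  have hle : ∀ (y : ℝ) (q : ℤ), ‖gaborFun l (y + q)‖ ≤
      2 * Real.exp 1 * Real.exp (-|(y - l.1) + q|) := fun y q => by
    have := norm_gaborFun_le l (y + q)
    rwa [show y + q - l.1 = y - l.1 + q by ring] at this
  have hs : ∀ y : ℝ, Summable fun q : ℤ => ‖gaborFun l (y + q)‖ := fun y =>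
    Summable.of_nonneg_of_le (fun _ => norm_nonneg _) (hle y) ((h _).1.mul_left _)
  refine ⟨by unfold gaborFun; fun_prop, hs, fun y => ?_⟩
  refine ((hs y).tsum_le_tsum (hle y) ((h _).1.mul_left _)).trans ?_
  rw [tsum_mul_left]
  have := (h (y - l.1)).2
  gcongr

/-! ### Lipschitz estimates at the centre -/

/-- Mean value inequality on a half-plane. The maximum of the two exponentials is weakened to their
sum so that each Gaussian can be estimated on its own. -/
theorem norm_exp_sub_exp_le (z z' : ℂ) :
    ‖Complex.exp z - Complex.exp z'‖ ≤
      (Real.exp z.re + Real.exp z'.re) * ‖z - z'‖ := by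
  have := (convex_halfSpace_re_le (max z.re z'.re)).norm_image_sub_le_of_norm_deriv_le (f := Complex.exp)
    (C := Real.exp (max z.re z'.re)) (x := z') (y := z)
    (fun x _ => Complex.differentiable_exp x)
    (fun x hx => by
      rw [Complex.deriv_exp, Complex.norm_exp]
      exact Real.exp_le_exp.2 hx)
    (show z'.re ≤ _ from le_max_right _ _) (show z.re ≤ _ from le_max_left _ _)
  refine this.trans ?_
  gcongr
  rcases max_cases z.re z'.re with h | h <;> rw [h.1] <;> simp [Real.exp_nonneg]

/-- The point of the unit square at which `Z e_0` vanishes. -/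
def centre : ℝ × ℝ := (1 / 2, 1 / 2)

/-- The closed unit square. -/
def unitSquare : Set (ℝ × ℝ) := Set.Icc 0 1 ×ˢ Set.Icc 0 1

/-- The growth `1 + |p| + |θ|` of the Lipschitz constants of `Z e_l`, `l = (p, θ)`. -/
def growth (l : ℝ × ℝ) : ℝ := 1 + |l.1| + |l.2|

theorem one_le_growth (l : ℝ × ℝ) : 1 ≤ growth l := by
  unfold growth
  linarith [abs_nonneg l.1, abs_nonneg l.2]

/-- The real part is a difference of squares. The imaginary part contains `q`, which lies within `u
+ 1` of `l.1` in absolute value; this is how `growth l` enters. -/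
theorem norm_zakExponent_sub_le (l w : ℝ × ℝ) (q : ℤ) {u : ℝ}
    (hu : |w.1 + q - l.1| ≤ u) (hu' : |centre.1 + q - l.1| ≤ u) :
    ‖zakExponent l w q - zakExponent l centre q‖ ≤
      20 * Real.pi * (1 + u) * growth l * ‖w - centre‖ := by
  have e : zakExponent l w q - zakExponent l centre q =
      ((-Real.pi * ((w.1 + q - l.1) + (centre.1 + q - l.1)) * (w.1 - centre.1) : ℝ) : ℂ) +
      ((2 * Real.pi * (l.2 * (w.1 - centre.1) - q * (w.2 - centre.2)) : ℝ) : ℂ) * Complex.I := by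
    simp only [zakExponent]
    push_cast
    ring
  have h1 : |w.1 - centre.1| ≤ ‖w - centre‖ := norm_fst_le (w - centre)
  have h2 : |w.2 - centre.2| ≤ ‖w - centre‖ := norm_snd_le (w - centre)
  have hq : |(q : ℝ)| ≤ u + |l.1| + 1 := by
    have : (q : ℝ) = (centre.1 + q - l.1) + l.1 - centre.1 := by ring
    rw [this]
    refine (abs_sub _ _).trans (add_le_add ((abs_add_le _ _).trans (by gcongr)) ?_)
    simp only [centre]; norm_num [abs_of_pos]
  have hu0 : 0 ≤ u := (abs_nonneg _).trans hu
  have hp := Real.pi_pos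
  rw [e]
  refine (norm_add_le _ _).trans ?_
  rw [norm_mul, Complex.norm_I, mul_one, Complex.norm_real, Complex.norm_real, Real.norm_eq_abs,
    Real.norm_eq_abs, abs_mul, abs_mul, abs_mul, abs_neg, abs_of_pos hp,
    abs_of_pos (by positivity : 0 < 2 * Real.pi)]
  have h3 : |w.1 + q - l.1 + (centre.1 + q - l.1)| ≤ u + u :=
    (abs_add_le _ _).trans (add_le_add hu hu')
  have h4 : |l.2 * (w.1 - centre.1) - q * (w.2 - centre.2)| ≤
      |l.2| * ‖w - centre‖ + (u + |l.1| + 1) * ‖w - centre‖ := by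
    refine (abs_sub _ _).trans ?_
    rw [abs_mul, abs_mul]
    gcongr
  calc _ ≤ Real.pi * (u + u) * ‖w - centre‖ +
        2 * Real.pi * (|l.2| * ‖w - centre‖ + (u + |l.1| + 1) * ‖w - centre‖) := by gcongr
    _ = Real.pi * ‖w - centre‖ * (4 * u + 2 * |l.2| + 2 * |l.1| + 2) := by ring
    _ ≤ Real.pi * ‖w - centre‖ * (20 * (1 + u) * growth l) := by
      gcongr
      unfold growth
      nlinarith [abs_nonneg l.1, abs_nonneg l.2, mul_nonneg hu0 (abs_nonneg l.1),
        mul_nonneg hu0 (abs_nonneg l.2)]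
    _ = _ := by ring

theorem IsWiener.summable_zakTerm {g : ℝ → ℂ} {M : ℝ} (h : IsWiener g M) (w : ℝ × ℝ) :
    Summable (zakTerm g w) :=
  Summable.of_norm (by simpa only [norm_zakTerm] using h.summable w.1)

theorem IsWiener.norm_zak_le {g : ℝ → ℂ} {M : ℝ} (h : IsWiener g M) (w : ℝ × ℝ) :
    ‖zak g w‖ ≤ M := by
  refine (norm_tsum_le_tsum_norm (by simpa only [norm_zakTerm] using h.summable w.1)).trans ?_
  simpa only [norm_zakTerm] using h.tsum_le w.1

/-- The Zak transforms of the Gabor functions are Lipschitz at the centre of the unit square. -/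
theorem exists_lipschitz_zak_gaborFun : ∃ C : ℝ, 0 < C ∧ ∀ l, ∀ w ∈ unitSquare,
    ‖zak (gaborFun l) w - zak (gaborFun l) centre‖ ≤ C * growth l * ‖w - centre‖ := by
  obtain ⟨M, hM, h⟩ := exists_bound_exp_neg_abs
  obtain ⟨M', -, hW⟩ := exists_isWiener_gaborFun
  have hp := Real.pi_pos
  refine ⟨2 * (40 * Real.pi * Real.exp 1) * (M + M), by positivity, fun l w hw => ?_⟩
  have hd : |w.1 - centre.1| ≤ 1 := by
    obtain ⟨h1, h2⟩ := hw.1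
    simp only [centre]
    rw [abs_le]
    constructor <;> linarith
  have hterm : ∀ q : ℤ, ‖zakTerm (gaborFun l) w q - zakTerm (gaborFun l) centre q‖ ≤
      2 * (40 * Real.pi * Real.exp 1) * growth l * ‖w - centre‖ *
        (Real.exp (-|(w.1 - l.1) + q|) + Real.exp (-|(centre.1 - l.1) + q|)) := by
    intro q
    set s := w.1 + q - l.1 with hs
    set t := centre.1 + q - l.1 with ht
    have hst : |s - t| ≤ 1 := by
      rwa [show s - t = w.1 - centre.1 by rw [hs, ht]; ring]
    have hst1 : |s| ≤ 1 + |t| := by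
      have := abs_sub_abs_le_abs_sub s t; linarith
    have hst2 : |t| ≤ 1 + |s| := by
      have := abs_sub_abs_le_abs_sub t s; rw [abs_sub_comm t s] at this; linarith
    rw [zakTerm_gaborFun, zakTerm_gaborFun, ← mul_sub, norm_mul, Complex.norm_real,
      Real.norm_eq_abs, abs_of_pos (by positivity)]
    have e1 := norm_exp_sub_exp_le (zakExponent l w q) (zakExponent l centre q)
    rw [re_zakExponent, re_zakExponent] at e1
    have g0 := one_le_growth l
    have hA : Real.exp (-Real.pi * s ^ 2) * ‖zakExponent l w q - zakExponent l centre q‖ ≤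
        40 * Real.pi * Real.exp 1 * growth l * ‖w - centre‖ * Real.exp (-|s|) := by
      -- Since `|s - t| ≤ 1`, the value `u = 1 + |s|` dominates both distances while depending only
      -- on the variable of the Gaussian it multiplies.
      have e2 := norm_zakExponent_sub_le l w q (u := 1 + |s|) (by linarith) hst2
      have e3 := one_add_abs_mul_gaussian_le s
      calc _ ≤ Real.exp (-Real.pi * s ^ 2) *
            (20 * Real.pi * (1 + (1 + |s|)) * growth l * ‖w - centre‖) := by gcongr
        _ ≤ Real.exp (-Real.pi * s ^ 2) *
            (20 * Real.pi * (2 * (1 + |s|)) * growth l * ‖w - centre‖) := by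
            gcongr; linarith [abs_nonneg s]
        _ = 40 * Real.pi * growth l * ‖w - centre‖ *
            ((1 + |s|) * Real.exp (-Real.pi * s ^ 2)) := by ring
        _ ≤ 40 * Real.pi * growth l * ‖w - centre‖ * (Real.exp 1 * Real.exp (-|s|)) := by gcongr
        _ = _ := by ring
    have hB : Real.exp (-Real.pi * t ^ 2) * ‖zakExponent l w q - zakExponent l centre q‖ ≤
        40 * Real.pi * Real.exp 1 * growth l * ‖w - centre‖ * Real.exp (-|t|) := by
      have e2 := norm_zakExponent_sub_le l w q (u := 1 + |t|) hst1 (by linarith)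
      have e3 := one_add_abs_mul_gaussian_le t
      calc _ ≤ Real.exp (-Real.pi * t ^ 2) *
            (20 * Real.pi * (1 + (1 + |t|)) * growth l * ‖w - centre‖) := by gcongr
        _ ≤ Real.exp (-Real.pi * t ^ 2) *
            (20 * Real.pi * (2 * (1 + |t|)) * growth l * ‖w - centre‖) := by
            gcongr; linarith [abs_nonneg t]
        _ = 40 * Real.pi * growth l * ‖w - centre‖ *
            ((1 + |t|) * Real.exp (-Real.pi * t ^ 2)) := by ring
        _ ≤ 40 * Real.pi * growth l * ‖w - centre‖ * (Real.exp 1 * Real.exp (-|t|)) := by gcongr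
        _ = _ := by ring
    rw [show (w.1 - l.1) + q = s by rw [hs]; ring, show (centre.1 - l.1) + q = t by rw [ht]; ring]
    calc _ ≤ 2 * ((Real.exp (-Real.pi * s ^ 2) + Real.exp (-Real.pi * t ^ 2)) *
          ‖zakExponent l w q - zakExponent l centre q‖) :=
        mul_le_mul rpow_quarter_le e1 (norm_nonneg _) (by norm_num)
      _ ≤ 2 * (40 * Real.pi * Real.exp 1 * growth l * ‖w - centre‖ * Real.exp (-|s|) +
          40 * Real.pi * Real.exp 1 * growth l * ‖w - centre‖ * Real.exp (-|t|)) := by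
        rw [add_mul]; gcongr
      _ = _ := by ring
  have hsum : Summable fun q : ℤ =>
      Real.exp (-|(w.1 - l.1) + q|) + Real.exp (-|(centre.1 - l.1) + q|) :=
    (h _).1.add (h _).1
  rw [zak, zak, ← ((hW l).summable_zakTerm w).tsum_sub ((hW l).summable_zakTerm centre)]
  have hn := Summable.of_nonneg_of_le (fun _ => norm_nonneg _) hterm (hsum.mul_left _)
  refine (norm_tsum_le_tsum_norm hn).trans ((hn.tsum_le_tsum hterm (hsum.mul_left _)).trans ?_)
  rw [tsum_mul_left, (h _).1.tsum_add (h _).1]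
  have g0 := one_le_growth l
  calc _ ≤ 2 * (40 * Real.pi * Real.exp 1) * growth l * ‖w - centre‖ * (M + M) := by
        gcongr
        · exact (h _).2
        · exact (h _).2
    _ = _ := by ring

/-! ### The simple zero of the Zak transform of the Gaussian -/

theorem norm_cosh_le (x : ℂ) : ‖Complex.cosh x‖ ≤ Real.exp |x.re| := by
  rw [Complex.cosh, norm_div, Complex.norm_ofNat, div_le_iff₀ (by norm_num)]
  refine (norm_add_le _ _).trans ?_
  rw [Complex.norm_exp, Complex.norm_exp, Complex.neg_re]
  have h1 := Real.exp_le_exp.2 (le_abs_self x.re)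
  have h2 := Real.exp_le_exp.2 (neg_le_abs x.re)
  linarith

/-- Induction with the addition formula. Keeping the factor `sinh x` makes every term of the theta
series vanish at least as fast as the leading one. -/
theorem norm_sinh_nat_mul_le (x : ℂ) (n : ℕ) :
    ‖Complex.sinh ((n + 1 : ℕ) * x)‖ ≤ (n + 1) * Real.exp (n * |x.re|) * ‖Complex.sinh x‖ := by
  induction n with
  | zero => simp
  | succ n ih =>
    have e : ((n + 1 + 1 : ℕ) : ℂ) * x = (n + 1 : ℕ) * x + x := by push_cast; ring
    rw [e, Complex.sinh_add]
    refine (norm_add_le _ _).trans ?_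
    rw [norm_mul, norm_mul]
    have h1 := norm_cosh_le x
    have h2 := norm_cosh_le ((n + 1 : ℕ) * x)
    have h3 : ((n + 1 : ℕ) * x).re = (n + 1 : ℕ) * x.re := by
      rw [← Complex.ofReal_natCast, Complex.re_ofReal_mul]
    rw [h3, abs_mul, Nat.abs_cast] at h2
    calc _ ≤ (n + 1) * Real.exp (n * |x.re|) * ‖Complex.sinh x‖ * Real.exp |x.re| +
          Real.exp ((n + 1 : ℕ) * |x.re|) * ‖Complex.sinh x‖ := by gcongr
      _ = _ := by
        have : Real.exp ((n + 1 : ℕ) * |x.re|) = Real.exp (n * |x.re|) * Real.exp |x.re| := by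
          rw [← Real.exp_add]; push_cast; ring_nf
        rw [this]; push_cast; ring

theorem norm_sinh_odd_le {x : ℂ} (hx : |x.re| ≤ Real.pi / 2) (n : ℕ) :
    ‖Complex.sinh ((2 * n + 1) * x)‖ ≤ 3 ^ n * Real.exp (n * Real.pi) * ‖Complex.sinh x‖ := by
  have h := norm_sinh_nat_mul_le x (2 * n)
  push_cast at h
  refine h.trans ?_
  have h1 : (2 * n + 1 : ℝ) ≤ 3 ^ n := by
    have := one_add_mul_le_pow (a := (2 : ℝ)) (by norm_num) n
    norm_num at this
    linarith
  have h2 : (2 * n : ℝ) * |x.re| ≤ n * Real.pi := by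
    have : (0 : ℝ) ≤ n := n.cast_nonneg
    nlinarith
  gcongr

/-- The identity is `|sinh(a + ib)|² = sinh² a + sin² b`; then `sinh` is bounded below by the
identity and `sin` by Jordan's inequality. The maximum is the sup norm of `(s, t)`, that is, the
norm of `ℝ × ℝ`. -/
theorem norm_sinh_ge (s : ℝ) {t : ℝ} (ht : |t| ≤ 1 / 2) :
    max |s| |t| ≤ ‖Complex.sinh (Real.pi * (s + t * Complex.I))‖ := by
  have hp := Real.pi_gt_three
  have e : (Real.pi * (s + t * Complex.I) : ℂ) =
      ((Real.pi * s : ℝ) : ℂ) + ((Real.pi * t : ℝ) : ℂ) * Complex.I := by push_cast; ring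
  have hn : ‖Complex.sinh (Real.pi * (s + t * Complex.I))‖ ^ 2 =
      Real.sinh (Real.pi * s) ^ 2 + Real.sin (Real.pi * t) ^ 2 := by
    rw [e, Complex.sinh_add, Complex.sinh_mul_I, Complex.cosh_mul_I, ← Complex.ofReal_sinh,
      ← Complex.ofReal_cosh, ← Complex.ofReal_sin, ← Complex.ofReal_cos, ← mul_assoc,
      ← Complex.ofReal_mul, ← Complex.ofReal_mul, Complex.sq_norm, Complex.normSq_add_mul_I]
    have h1 := Real.cosh_sq (Real.pi * s)
    have h2 := Real.sin_sq_add_cos_sq (Real.pi * t)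
    rw [mul_pow, mul_pow, h1]
    linear_combination (Real.sinh (Real.pi * s) ^ 2) * h2
  have h1 : |s| ≤ |Real.sinh (Real.pi * s)| := by
    rw [Real.abs_sinh, abs_mul, abs_of_pos Real.pi_pos]
    have := Real.self_le_sinh_iff.2 (by positivity : 0 ≤ Real.pi * |s|)
    nlinarith [abs_nonneg s]
  have h2 : |t| ≤ |Real.sin (Real.pi * t)| := by
    have h3 : |Real.sin (Real.pi * t)| = |Real.sin (Real.pi * |t|)| := by
      rcases abs_cases t with h | h <;> simp [h.1]
    have h4 := Real.mul_le_sin (x := Real.pi * |t|) (by positivity) (by nlinarith)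
    have h5 : 2 / Real.pi * (Real.pi * |t|) = 2 * |t| := by field_simp
    rw [h3]
    have := le_abs_self (Real.sin (Real.pi * |t|))
    linarith [abs_nonneg t]
  refine max_le ?_ ?_ <;> refine abs_le_of_sq_le_sq' ?_ (norm_nonneg _) |>.2
  · rw [hn]
    have := pow_le_pow_left₀ (abs_nonneg s) h1 2
    simp only [sq_abs] at this ⊢
    nlinarith [sq_nonneg (Real.sin (Real.pi * t))]
  · rw [hn]
    have := pow_le_pow_left₀ (abs_nonneg t) h2 2
    simp only [sq_abs] at this ⊢
    nlinarith [sq_nonneg (Real.sinh (Real.pi * s))]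

theorem exp_neg_pi_le : Real.exp (-Real.pi) ≤ 1 / 20 := by
  have h1 : (20 : ℝ) ≤ Real.exp 3 := by
    have h := Real.exp_one_gt_d9
    have : Real.exp 3 = Real.exp 1 ^ 3 := by rw [← Real.exp_nat_mul]; norm_num
    rw [this]
    calc (20 : ℝ) ≤ 2.718 ^ 3 := by norm_num
      _ ≤ _ := by gcongr; linarith
  have h2 : Real.exp (-Real.pi) ≤ Real.exp (-3) :=
    Real.exp_le_exp.2 (by linarith [Real.pi_gt_three])
  rw [Real.exp_neg 3] at h2
  refine h2.trans ?_
  rw [inv_le_comm₀ (by positivity) (by norm_num)]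
  linarith

/-- The terms of the expansion of `Z e_0` into hyperbolic sines at the centre. -/
def thetaTerm (x : ℂ) (n : ℕ) : ℂ :=
  (-1) ^ n * Complex.exp (-Real.pi * (n + 1 / 2) ^ 2) * Complex.sinh ((2 * n + 1) * x)

/-- In `(n + 1/2)² = n² + n + 1/4` the linear part cancels the growth `exp(nπ)` of the hyperbolic
sine. The rest, `exp(-π n²) ≤ 20⁻ⁿ`, beats the factor `3ⁿ`. -/
theorem norm_thetaTerm_le {x : ℂ} (hx : |x.re| ≤ Real.pi / 2) (n : ℕ) :
    ‖thetaTerm x n‖ ≤ Real.exp (-Real.pi / 4) * ‖Complex.sinh x‖ * (3 / 20) ^ n := by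
  have e : (-Real.pi * (n + 1 / 2) ^ 2 : ℂ) = ((-Real.pi * (n + 1 / 2) ^ 2 : ℝ) : ℂ) := by
    push_cast; ring
  rw [thetaTerm, norm_mul, norm_mul, norm_pow, norm_neg, norm_one, one_pow, one_mul, e,
    ← Complex.ofReal_exp, Complex.norm_real, Real.norm_eq_abs, Real.abs_exp]
  have h1 : Real.exp (-Real.pi * (n + 1 / 2) ^ 2) * Real.exp (n * Real.pi) ≤
      Real.exp (-Real.pi / 4) * (1 / 20) ^ n := by
    have h2 : Real.exp (-Real.pi * (n + 1 / 2) ^ 2) * Real.exp (n * Real.pi) =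
        Real.exp (-Real.pi / 4) * Real.exp ((n ^ 2 : ℕ) * (-Real.pi)) := by
      rw [← Real.exp_add, ← Real.exp_add]
      congr 1; push_cast; ring
    rw [h2, Real.exp_nat_mul]
    gcongr
    calc Real.exp (-Real.pi) ^ n ^ 2 ≤ Real.exp (-Real.pi) ^ n :=
          pow_le_pow_of_le_one (Real.exp_pos _).le
            (exp_neg_pi_le.trans (by norm_num)) (Nat.le_self_pow (by norm_num) n)
      _ ≤ (1 / 20) ^ n := by gcongr; exact exp_neg_pi_le
  calc _ ≤ Real.exp (-Real.pi * (n + 1 / 2) ^ 2) *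
        (3 ^ n * Real.exp (n * Real.pi) * ‖Complex.sinh x‖) := by
        gcongr; exact norm_sinh_odd_le hx n
    _ = Real.exp (-Real.pi * (n + 1 / 2) ^ 2) * Real.exp (n * Real.pi) *
        (3 ^ n * ‖Complex.sinh x‖) := by ring
    _ ≤ Real.exp (-Real.pi / 4) * (1 / 20) ^ n * (3 ^ n * ‖Complex.sinh x‖) := by gcongr
    _ = _ := by
      rw [show (3 / 20 : ℝ) = 3 * (1 / 20) by norm_num, mul_pow]; ring

theorem summable_thetaTerm {x : ℂ} (hx : |x.re| ≤ Real.pi / 2) : Summable (thetaTerm x) :=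
  Summable.of_norm_bounded
    ((summable_geometric_of_lt_one (by norm_num) (by norm_num)).mul_left _) (norm_thetaTerm_le hx)

/-- The terms after the first add up to at most `3/17` of the leading one, so more than half of it
survives. -/
theorem norm_tsum_thetaTerm_ge {x : ℂ} (hx : |x.re| ≤ Real.pi / 2) :
    Real.exp (-Real.pi / 4) * ‖Complex.sinh x‖ * (1 / 2) ≤ ‖∑' n, thetaTerm x n‖ := by
  have hs := summable_thetaTerm hx
  rw [hs.tsum_eq_zero_add]
  have h0 : ‖thetaTerm x 0‖ = Real.exp (-Real.pi / 4) * ‖Complex.sinh x‖ := by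
    have e : (-Real.pi * (1 / 2) ^ 2 : ℂ) = ((-Real.pi / 4 : ℝ) : ℂ) := by push_cast; ring
    simp only [thetaTerm, pow_zero, one_mul, Nat.cast_zero, mul_zero, zero_add]
    rw [e, norm_mul, ← Complex.ofReal_exp, Complex.norm_real, Real.norm_eq_abs, Real.abs_exp]
  have hg : HasSum (fun n : ℕ => Real.exp (-Real.pi / 4) * ‖Complex.sinh x‖ * (3 / 20) ^ (n + 1))
      (Real.exp (-Real.pi / 4) * ‖Complex.sinh x‖ * (3 / 17)) := by
    refine HasSum.mul_left _ ?_
    have := (hasSum_geometric_of_lt_one (r := (3 / 20 : ℝ)) (by norm_num)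
      (by norm_num)).mul_left (3 / 20)
    convert this using 1
    · ext n; rw [pow_succ']
    · norm_num
  have h1 : ‖∑' n, thetaTerm x (n + 1)‖ ≤
      Real.exp (-Real.pi / 4) * ‖Complex.sinh x‖ * (3 / 17) :=
    tsum_of_norm_bounded hg fun n => norm_thetaTerm_le hx (n + 1)
  have h2 := norm_sub_le_norm_add (thetaTerm x 0) (∑' n, thetaTerm x (n + 1))
  have h3 : 0 ≤ Real.exp (-Real.pi / 4) * ‖Complex.sinh x‖ := by positivity
  linarith

/-- In coordinates centred at the zero, the indices `n` and `-n - 1` carry the same Gaussian weight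
and opposite signs, so each pair combines into a hyperbolic sine. -/
theorem hasSum_zakTerm_gaborFun_zero (s t : ℝ) (hs : |s| ≤ 1 / 2) :
    HasSum (zakTerm (gaborFun 0) (s + 1 / 2, t + 1 / 2))
      (((2 : ℝ) ^ (1 / 4 : ℝ) : ℝ) * Complex.exp (-Real.pi * s ^ 2 + Real.pi * t * Complex.I) *
        (-2) * ∑' n, thetaTerm (Real.pi * (s + t * Complex.I)) n) := by
  set x : ℂ := Real.pi * (s + t * Complex.I) with hx
  set K : ℂ := ((2 : ℝ) ^ (1 / 4 : ℝ) : ℝ) *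
    Complex.exp (-Real.pi * s ^ 2 + Real.pi * t * Complex.I) with hK
  have hre : |x.re| ≤ Real.pi / 2 := by
    rw [hx, Complex.re_ofReal_mul, abs_mul, abs_of_pos Real.pi_pos]
    simp only [Complex.add_re, Complex.ofReal_re, Complex.re_ofReal_mul, Complex.I_re, mul_zero,
      add_zero]
    nlinarith [Real.pi_pos]
  have hneg (q : ℤ) : Complex.exp (-Real.pi * q * Complex.I) = (-1) ^ q := by
    rw [show (-Real.pi * q * Complex.I : ℂ) = q * (-(Real.pi * Complex.I)) by ring,
      Complex.exp_int_mul, Complex.exp_neg, Complex.exp_pi_mul_I]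
    norm_num
  have hterm (q : ℤ) : zakTerm (gaborFun 0) (s + 1 / 2, t + 1 / 2) q =
      K * ((-1) ^ q * Complex.exp (-Real.pi * (q + 1 / 2) ^ 2) *
        Complex.exp (-((2 * q + 1) * x))) := by
    rw [zakTerm_gaborFun, hK, ← hneg, mul_assoc, ← Complex.exp_add, ← Complex.exp_add,
      ← Complex.exp_add, zakExponent, hx]
    congr 2
    simp only [Prod.fst_zero, Prod.snd_zero]
    push_cast
    ring
  have hodd (n : ℕ) : zakTerm (gaborFun 0) (s + 1 / 2, t + 1 / 2) (n : ℤ) +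
      zakTerm (gaborFun 0) (s + 1 / 2, t + 1 / 2) (-((n : ℤ) + 1)) =
      K * (-2) * thetaTerm x n := by
    rw [hterm, hterm, thetaTerm, Complex.sinh]
    have e1 : ((-1 : ℂ)) ^ (-((n : ℤ) + 1)) = -(-1) ^ n := by
      rw [zpow_neg, zpow_add₀ (by norm_num)]
      simp [inv_neg, ← inv_pow]
    have e2 : (-Real.pi * (((-((n : ℤ) + 1) : ℤ) : ℂ) + 1 / 2) ^ 2 : ℂ) =
        -Real.pi * (n + 1 / 2) ^ 2 := by push_cast; ring
    have e3 : (-((2 * ((-((n : ℤ) + 1) : ℤ) : ℂ) + 1) * x)) = (2 * n + 1) * x := by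
      push_cast; ring
    rw [e1, e2, e3, zpow_natCast, Int.cast_natCast]
    ring
  obtain ⟨M, -, hW⟩ := exists_isWiener_gaborFun
  have hsum := (hW 0).summable_zakTerm (s + 1 / 2, t + 1 / 2)
  have h1 := hsum.hasSum.nat_add_neg_add_one
  simp only [hodd] at h1
  have h2 := (summable_thetaTerm hre).hasSum.mul_left (K * (-2))
  exact h1.unique h2 ▸ hsum.hasSum

/-- The Zak transform of the Gaussian has no other zero in the unit square than the centre, and
the zero at the centre is simple. -/
theorem exists_zak_gaussian_ge : ∃ c : ℝ, 0 < c ∧ ∀ w ∈ unitSquare,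
    c * ‖w - centre‖ ≤ ‖zak (gaborFun 0) w‖ := by
  -- The second factor is the least value of `exp(-π s²)` for `|s| ≤ 1/2`, the third the weight of
  -- the leading theta term; the `2` from pairing cancels the `1/2` lost to the tail.
  refine ⟨2 ^ (1 / 4 : ℝ) * Real.exp (-Real.pi * (1 / 2) ^ 2) * Real.exp (-Real.pi / 4),
    by positivity, fun w hw => ?_⟩
  obtain ⟨⟨h1, h2⟩, h3, h4⟩ := hw
  obtain ⟨s, hs⟩ : ∃ s, w.1 = s + 1 / 2 := ⟨w.1 - 1 / 2, by ring⟩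
  obtain ⟨t, ht⟩ : ∃ t, w.2 = t + 1 / 2 := ⟨w.2 - 1 / 2, by ring⟩
  have hs' : |s| ≤ 1 / 2 := by rw [abs_le]; constructor <;> linarith
  have ht' : |t| ≤ 1 / 2 := by rw [abs_le]; constructor <;> linarith
  have hw' : w = (s + 1 / 2, t + 1 / 2) := Prod.ext hs ht
  have hn : ‖w - centre‖ = max |s| |t| := by
    rw [hw', centre, Prod.norm_def]; simp
  have hre : |(Real.pi * (s + t * Complex.I) : ℂ).re| ≤ Real.pi / 2 := by
    rw [Complex.re_ofReal_mul, abs_mul, abs_of_pos Real.pi_pos]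
    simp only [Complex.add_re, Complex.ofReal_re, Complex.re_ofReal_mul, Complex.I_re, mul_zero,
      add_zero]
    nlinarith [Real.pi_pos]
  have hexp : ‖Complex.exp (-Real.pi * s ^ 2 + Real.pi * t * Complex.I)‖ =
      Real.exp (-Real.pi * s ^ 2) := by
    rw [show (-Real.pi * s ^ 2 + Real.pi * t * Complex.I : ℂ) =
      ((-Real.pi * s ^ 2 : ℝ) : ℂ) + ((Real.pi * t : ℝ) : ℂ) * Complex.I by push_cast; ring,
      Complex.norm_exp]
    congr 1
    rw [Complex.add_re, Complex.ofReal_re, Complex.re_ofReal_mul, Complex.I_re]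
    ring
  rw [hn, zak, hw', (hasSum_zakTerm_gaborFun_zero s t hs').tsum_eq, norm_mul, norm_mul, norm_mul,
    hexp, Complex.norm_real, Real.norm_eq_abs, abs_of_pos (by positivity : 0 < (2 : ℝ) ^ (1 / 4 : ℝ)), norm_neg,
    Complex.norm_ofNat]
  have h5 := norm_tsum_thetaTerm_ge hre
  have h6 := norm_sinh_ge s ht'
  have h7 : Real.exp (-Real.pi * (1 / 2) ^ 2) ≤ Real.exp (-Real.pi * s ^ 2) := by
    rw [Real.exp_le_exp]
    have : s ^ 2 ≤ (1 / 2) ^ 2 := sq_le_sq' (by linarith [(abs_le.1 hs').1]) (abs_le.1 hs').2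
    nlinarith [Real.pi_pos]
  calc _ ≤ 2 ^ (1 / 4 : ℝ) * Real.exp (-Real.pi * s ^ 2) * Real.exp (-Real.pi / 4) *
        ‖Complex.sinh (Real.pi * (s + t * Complex.I))‖ := by gcongr
    _ = 2 ^ (1 / 4 : ℝ) * Real.exp (-Real.pi * s ^ 2) * 2 * (Real.exp (-Real.pi / 4) *
        ‖Complex.sinh (Real.pi * (s + t * Complex.I))‖ * (1 / 2)) := by ring
    _ ≤ _ := by gcongr

/-! ### The value of the sharp Gabor function at the centre -/

theorem Theta_zero_ne_zero : Theta 0 ≠ 0 := by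
  have hterm : ∀ q : ℤ, jacobiTheta₂_term q 0 Complex.I = ((Real.exp (-Real.pi * q ^ 2) : ℝ) : ℂ) := by
    intro q
    rw [jacobiTheta₂_term, Complex.ofReal_exp]
    congr 1
    push_cast
    linear_combination (Real.pi * q ^ 2 : ℂ) * Complex.I_sq
  have hs : Summable fun q : ℤ => Real.exp (-Real.pi * (q : ℝ) ^ 2) := by
    have := (hasSum_jacobiTheta₂_term 0 (τ := Complex.I) (by simp)).summable
    simp only [hterm] at this
    exact Complex.summable_ofReal.1 this
  rw [Theta, jacobiTheta₂]
  simp only [hterm]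
  rw [← Complex.ofReal_tsum]
  have : 0 < ∑' q : ℤ, Real.exp (-Real.pi * (q : ℝ) ^ 2) :=
    hs.tsum_pos (fun _ => (Real.exp_pos _).le) 0 (Real.exp_pos _)
  rw [← Complex.ofReal_mul, Complex.ofReal_ne_zero]
  positivity

/-- The position `1/2` cancels, leaving the Gaussian `exp(-π q²)`, and the phase is `π/2` for every
`q`. This explains the normalisation of `γ^♯`. -/
theorem zak_gaborFun_sharp_centre : zak (gaborFun sharp) centre = Complex.I * Theta 0 := by
  rw [zak, Theta, jacobiTheta₂, ← tsum_mul_left, ← tsum_mul_left]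
  refine tsum_congr fun q => ?_
  rw [zakTerm_gaborFun, jacobiTheta₂_term]
  rw [mul_left_comm]
  congr 1
  have : zakExponent sharp centre q = Real.pi / 2 * Complex.I +
      (2 * Real.pi * Complex.I * q * 0 + Real.pi * Complex.I * q ^ 2 * Complex.I) := by
    rw [zakExponent, sharp, centre]
    push_cast
    linear_combination (-Real.pi * q ^ 2 : ℂ) * Complex.I_sq
  rw [this, Complex.exp_add, Complex.exp_pi_div_two_mul_I]

/-! ### Parseval's identity and the isometry of the Zak transform -/

theorem hasSum_norm_sq_of_orthonormal {ι E : Type*} [NormedAddCommGroup E] [InnerProductSpace ℂ E]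
    {v : ι → E} (hv : Orthonormal ℂ v) {a : ι → ℂ} {x : E} (h : HasSum (fun i => a i • v i) x) :
    HasSum (fun i => ‖a i‖ ^ 2) (‖x‖ ^ 2) := by
  classical
  have h1 : ∀ i, inner ℂ (v i) x = a i := by
    intro i
    have h2 := h.mapL (innerSL ℂ (v i))
    simp only [innerSL_apply_apply, inner_smul_right] at h2
    refine h2.unique ?_
    have e : a i * inner ℂ (v i) (v i) = a i := by
      rw [inner_self_eq_norm_sq_to_K, hv.1 i]; simp
    rw [← e]
    exact hasSum_single i fun j hj => by rw [hv.2 hj.symm, mul_zero]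
  have h3 := h.mapL (innerSL ℂ x)
  simp only [innerSL_apply_apply, inner_smul_right] at h3
  have h4 : ∀ i, a i * inner ℂ x (v i) = ((‖a i‖ ^ 2 : ℝ) : ℂ) := by
    intro i
    rw [← inner_conj_symm, h1, Complex.mul_conj, Complex.normSq_eq_norm_sq]
  simp only [h4, inner_self_eq_norm_sq_to_K] at h3
  exact Complex.hasSum_ofReal.1 (by simpa using h3)

/-- Parseval's identity for absolutely convergent trigonometric series. -/
theorem integral_norm_sq_trigonometric {a : ℤ → ℂ} (ha : Summable fun q => ‖a q‖) :
    ∫ t in Set.Ioc (0 : ℝ) 1, ‖∑' q : ℤ, a q * Complex.exp (-(2 * Real.pi * Complex.I * q * t))‖ ^ 2 =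
      ∑' q, ‖a q‖ ^ 2 := by
  -- Absolute summability gives convergence in the sup norm, so one continuous `u` supplies both the
  -- pointwise values and the `L₂` class.
  have hs : Summable fun q : ℤ => a q • (fourier (-q) : C(AddCircle (1 : ℝ), ℂ)) := by
    refine Summable.of_norm ?_
    simpa only [norm_smul, fourier_norm, mul_one] using ha
  obtain ⟨u, hu⟩ := hs
  have h1 := hu.mapL (ContinuousMap.toLp (E := ℂ) 2 (@AddCircle.haarAddCircle (1 : ℝ) _) ℂ)
  simp only [map_smul] at h1
  have hv : Orthonormal ℂ fun q : ℤ => fourierLp (T := (1 : ℝ)) 2 (-q) :=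
    (orthonormal_fourier (T := (1 : ℝ))).comp _ neg_injective
  have h2 := hasSum_norm_sq_of_orthonormal hv h1
  rw [h2.tsum_eq]
  have hval : ∀ t : ℝ, u (t : AddCircle (1 : ℝ)) =
      ∑' q : ℤ, a q * Complex.exp (-(2 * Real.pi * Complex.I * q * t)) := by
    intro t
    have h3 := hu.map (ContinuousMap.evalCLM ℂ (t : AddCircle (1 : ℝ)))
      (ContinuousMap.evalCLM ℂ (t : AddCircle (1 : ℝ))).continuous
    refine (h3.tsum_eq.symm.trans (tsum_congr fun q => ?_))
    simp only [Function.comp_apply, ContinuousMap.evalCLM_apply, ContinuousMap.smul_apply,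
      smul_eq_mul, fourier_coe_apply]
    congr 2
    push_cast
    ring
  have h4 : ‖(ContinuousMap.toLp (E := ℂ) 2 (@AddCircle.haarAddCircle (1 : ℝ) _) ℂ) u‖ ^ 2 =
      ∫ t : AddCircle (1 : ℝ), ‖u t‖ ^ 2 ∂AddCircle.haarAddCircle := by
    have h5 := ContinuousMap.inner_toLp (𝕜 := ℂ) (@AddCircle.haarAddCircle (1 : ℝ) _) u u
    have h6 : ∀ t, u t * (starRingEnd ℂ) (u t) = ((‖u t‖ ^ 2 : ℝ) : ℂ) := fun t => by
      rw [Complex.mul_conj, Complex.normSq_eq_norm_sq]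
    simp only [h6] at h5
    rw [integral_complex_ofReal, inner_self_eq_norm_sq_to_K] at h5
    exact Complex.ofReal_injective (by simpa using h5)
  rw [h4, AddCircle.integral_haarAddCircle, inv_one, one_smul,
    ← AddCircle.integral_preimage 1 0, zero_add]
  simp only [hval]

/-- The half-open unit square, a fundamental domain of `ℤ × ℤ`. -/
def cell : Set (ℝ × ℝ) := Set.Ioc 0 1 ×ˢ Set.Ioc 0 1

theorem cell_subset_unitSquare : cell ⊆ unitSquare :=
  Set.prod_mono Set.Ioc_subset_Icc_self Set.Ioc_subset_Icc_self

theorem measurableSet_cell : MeasurableSet cell := measurableSet_Ioc.prod measurableSet_Ioc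

theorem volume_restrict_cell : (volume : Measure (ℝ × ℝ)).restrict cell =
    ((volume : Measure ℝ).restrict (Set.Ioc 0 1)).prod
      ((volume : Measure ℝ).restrict (Set.Ioc 0 1)) := by
  rw [cell, Measure.volume_eq_prod, Measure.prod_restrict]

instance : IsFiniteMeasure ((volume : Measure (ℝ × ℝ)).restrict cell) := by
  rw [volume_restrict_cell]; infer_instance

theorem IsWiener.measurable_zak {g : ℝ → ℂ} {M : ℝ} (h : IsWiener g M) : Measurable (zak g) := by
  refine measurable_of_tendsto_metrizable' (atTop : Filter (Finset ℤ))
    (f := fun s w => ∑ q ∈ s, zakTerm g w q) (fun s => ?_)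
    (tendsto_pi_nhds.2 fun w => (h.summable_zakTerm w).hasSum)
  refine Finset.measurable_sum _ fun q _ => ?_
  have := h.continuous
  unfold zakTerm
  exact (by fun_prop : Continuous _).measurable

theorem IsWiener.memLp_zak {g : ℝ → ℂ} {M : ℝ} (h : IsWiener g M) (p : ENNReal) :
    MemLp (zak g) p (volume.restrict cell) :=
  MemLp.of_bound h.measurable_zak.aestronglyMeasurable M (ae_of_all _ h.norm_zak_le)

/-- The Zak transform is isometric. -/
theorem IsWiener.integral_norm_sq_zak {g : ℝ → ℂ} {M : ℝ} (h : IsWiener g M)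
    (h2 : MemLp g 2 volume) :
    ∫ w in cell, ‖zak g w‖ ^ 2 = ∫ x, ‖g x‖ ^ 2 := by
  have hi : Integrable (fun x => ‖g x‖ ^ 2) := h2.integrable_norm_pow (by norm_num)
  have hI : Integrable (fun w => ‖zak g w‖ ^ 2) (volume.restrict cell) :=
    (h.memLp_zak 2).integrable_norm_pow (by norm_num)
  rw [volume_restrict_cell] at hI ⊢
  rw [integral_prod _ hI]
  -- For fixed `y` the Zak transform is a Fourier series with coefficients `g(y + q)`. Integrating
  -- Parseval's identity over one period then unfolds to the whole line.
  have e1 : ∀ y : ℝ, ∫ t in Set.Ioc (0 : ℝ) 1, ‖zak g (y, t)‖ ^ 2 = ∑' q : ℤ, ‖g (y + q)‖ ^ 2 :=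
    fun y => integral_norm_sq_trigonometric (a := fun q : ℤ => g (y + q)) (h.summable y)
  simp only [e1]
  have hs := hi.hasSum_intervalIntegral_comp_add_int
  simp only [intervalIntegral.integral_of_le zero_le_one] at hs
  rw [← hs.tsum_eq]
  refine (hasSum_integral_of_summable_integral_norm (fun q => ?_) ?_).tsum_eq.symm
  · exact (hi.comp_add_right (q : ℝ)).integrableOn
  · simpa using hs.summable

theorem zakTerm_add (g h : ℝ → ℂ) (w : ℝ × ℝ) : zakTerm (g + h) w = zakTerm g w + zakTerm h w := by
  ext q; simp [zakTerm, add_mul]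

theorem zakTerm_smul (c : ℂ) (g : ℝ → ℂ) (w : ℝ × ℝ) : zakTerm (c • g) w = c • zakTerm g w := by
  ext q; simp [zakTerm, mul_assoc]

theorem IsWiener.add {g h : ℝ → ℂ} {M N : ℝ} (hg : IsWiener g M) (hh : IsWiener h N) :
    IsWiener (g + h) (M + N) := by
  have hs : ∀ y : ℝ, Summable fun q : ℤ => ‖(g + h) (y + q)‖ := fun y =>
    Summable.of_nonneg_of_le (fun _ => norm_nonneg _) (fun _ => norm_add_le _ _)
      ((hg.summable y).add (hh.summable y))
  refine ⟨hg.continuous.add hh.continuous, hs, fun y => ?_⟩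
  refine ((hs y).tsum_le_tsum (fun _ => norm_add_le _ _)
    ((hg.summable y).add (hh.summable y))).trans ?_
  rw [(hg.summable y).tsum_add (hh.summable y)]
  exact add_le_add (hg.tsum_le y) (hh.tsum_le y)

theorem IsWiener.smul {g : ℝ → ℂ} {M : ℝ} (hg : IsWiener g M) (c : ℂ) :
    IsWiener (c • g) (‖c‖ * M) := by
  refine ⟨hg.continuous.const_smul c, fun y => ?_, fun y => ?_⟩ <;>
    simp only [Pi.smul_apply, norm_smul]
  · exact (hg.summable y).mul_left _
  · rw [tsum_mul_left]
    exact mul_le_mul_of_nonneg_left (hg.tsum_le y) (norm_nonneg _)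

theorem zak_add {g h : ℝ → ℂ} {M N : ℝ} (hg : IsWiener g M) (hh : IsWiener h N) (w : ℝ × ℝ) :
    zak (g + h) w = zak g w + zak h w := by
  rw [zak, zakTerm_add, zak, zak, ← (hg.summable_zakTerm w).tsum_add (hh.summable_zakTerm w)]
  rfl

theorem zak_smul (c : ℂ) (g : ℝ → ℂ) (w : ℝ × ℝ) : zak (c • g) w = c * zak g w := by
  rw [zak, zakTerm_smul, zak, ← tsum_mul_left]
  rfl

theorem isWiener_zero : IsWiener 0 0 :=
  ⟨continuous_zero, fun _ => by simp [summable_zero], fun _ => by simp⟩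

theorem exists_isWiener_sum {ι : Type*} (s : Finset ι) {g : ι → ℝ → ℂ}
    (hg : ∀ i, ∃ M, IsWiener (g i) M) :
    (∃ M, IsWiener (∑ i ∈ s, g i) M) ∧ ∀ w, zak (∑ i ∈ s, g i) w = ∑ i ∈ s, zak (g i) w := by
  classical
  induction s using Finset.induction_on with
  | empty => exact ⟨⟨0, by simpa using isWiener_zero⟩, fun w => by simp [zak, zakTerm]⟩
  | insert i s hi ih =>
    obtain ⟨⟨M, hM⟩, h⟩ := ih
    obtain ⟨N, hN⟩ := hg i
    simp only [Finset.sum_insert hi]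
    exact ⟨⟨_, hN.add hM⟩, fun w => by rw [zak_add hN hM, h]⟩

/-! ### Fourier series on the unit square -/

/-- The characters of the unit square. -/
def character (n : ℤ × ℤ) (w : ℝ × ℝ) : ℂ :=
  Complex.exp (2 * Real.pi * Complex.I * (n.2 * w.1 - n.1 * w.2))

/-- The point of the phase plane with integral coordinates `n`. -/
def latticePoint (n : ℤ × ℤ) : ℝ × ℝ := (n.1, n.2)

/-- Shifting the summation index by `n.1` absorbs the translation. The leftover phase is `2π` times
the integer `n.2 (q + n.1)`, which is where integrality of the lattice enters. -/
theorem zak_gaborFun_latticePoint (n : ℤ × ℤ) (w : ℝ × ℝ) :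
    zak (gaborFun (latticePoint n)) w = character n w * zak (gaborFun 0) w := by
  rw [zak, zak, ← tsum_mul_left, ← (Equiv.addRight n.1).tsum_eq]
  refine tsum_congr fun q => ?_
  rw [zakTerm_gaborFun, zakTerm_gaborFun, mul_left_comm, character, ← Complex.exp_add]
  congr 1
  rw [← mul_one (Complex.exp (2 * Real.pi * Complex.I * _ + _)),
    ← Complex.exp_int_mul_two_pi_mul_I (n.2 * (q + n.1)), ← Complex.exp_add, zakExponent,
    zakExponent, latticePoint, Equiv.coe_addRight]
  congr 1
  simp only [Prod.fst_zero, Prod.snd_zero]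
  push_cast
  ring

local instance : MeasureSpace UnitAddCircle := ⟨AddCircle.haarAddCircle⟩

/-- The section of `ℝ → ℝ / ℤ` with values in `(0, 1]`. -/
def circleSection (t : UnitAddCircle) : ℝ := AddCircle.equivIoc 1 0 t

theorem coe_circleSection (t : UnitAddCircle) : (circleSection t : UnitAddCircle) = t :=
  (AddCircle.equivIoc 1 0).symm_apply_apply t

theorem measurePreserving_circleSection :
    MeasurePreserving circleSection AddCircle.haarAddCircle
      ((volume : Measure ℝ).restrict (Set.Ioc 0 1)) := by
  have h := (measurePreserving_subtype_coe (μa := (volume : Measure ℝ))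
    (measurableSet_Ioc (a := (0 : ℝ)) (b := 0 + 1))).comp
    (AddCircle.measurePreserving_equivIoc (a := 0) (1 : ℝ))
  rw [AddCircle.volume_eq_smul_haarAddCircle, ENNReal.ofReal_one, one_smul] at h
  have e : Set.Ioc (0 : ℝ) 1 = Set.Ioc 0 (0 + 1) := by rw [zero_add]
  rw [e]
  exact h

/-- The section of the torus with values in the half-open unit square. -/
def torusSection (t : UnitAddTorus (Fin 2)) : ℝ × ℝ := (circleSection (t 0), circleSection (t 1))

theorem measurePreserving_torusSection :
    MeasurePreserving torusSection volume (volume.restrict cell) := by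
  rw [volume_restrict_cell]
  exact (measurePreserving_circleSection.prod measurePreserving_circleSection).comp
    (measurePreserving_finTwoArrow AddCircle.haarAddCircle)

theorem continuous_character (n : ℤ × ℤ) : Continuous (character n) := by
  unfold character; fun_prop

theorem norm_character (n : ℤ × ℤ) (w : ℝ × ℝ) : ‖character n w‖ = 1 := by
  have : (2 * Real.pi * Complex.I * (n.2 * w.1 - n.1 * w.2) : ℂ) =
      ((2 * Real.pi * (n.2 * w.1 - n.1 * w.2) : ℝ) : ℂ) * Complex.I := by push_cast; ring
  rw [character, this, Complex.norm_exp_ofReal_mul_I]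

theorem memLp_character (n : ℤ × ℤ) : MemLp (character n) 2 (volume.restrict cell) :=
  MemLp.of_bound (continuous_character n).aestronglyMeasurable 1
    (ae_of_all _ fun w => (norm_character n w).le)

/-- The indexing of the characters of the torus by the lattice. -/
def latticeEquiv : ℤ × ℤ ≃ (Fin 2 → ℤ) where
  toFun n := ![n.2, -n.1]
  invFun m := (-m 1, m 0)
  left_inv n := by simp
  right_inv m := by ext i; fin_cases i <;> simp

theorem mFourier_latticeEquiv (n : ℤ × ℤ) (t : UnitAddTorus (Fin 2)) :
    UnitAddTorus.mFourier (latticeEquiv n) t = character n (torusSection t) := by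
  simp only [UnitAddTorus.mFourier, ContinuousMap.coe_mk, Fin.prod_univ_two, latticeEquiv,
    Equiv.coe_fn_mk, Matrix.cons_val_zero, Matrix.cons_val_one]
  rw [← coe_circleSection (t 0), ← coe_circleSection (t 1), fourier_coe_apply, fourier_coe_apply,
    ← Complex.exp_add, character, torusSection]
  congr 1
  push_cast
  ring

/-- The Fourier coefficients of a function on the unit square. -/
def cellCoeff (F : ℝ × ℝ → ℂ) (n : ℤ × ℤ) : ℂ :=
  ∫ w in cell, starRingEnd ℂ (character n w) * F w

/-- Composition with `torusSection` is an isometry into `L₂` of the torus, where the characters form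
a Hilbert basis. An isometry reflects convergence of sums, so its surjectivity is not needed. -/
theorem hasSum_fourier_cell {F : ℝ × ℝ → ℂ} (hF : MemLp F 2 (volume.restrict cell)) :
    HasSum (fun n => cellCoeff F n • (memLp_character n).toLp (character n)) (hF.toLp F) ∧
    HasSum (fun n => ‖cellCoeff F n‖ ^ 2) (‖hF.toLp F‖ ^ 2) := by
  let J := Lp.compMeasurePreservingₗᵢ (E := ℂ) (p := 2) ℂ torusSection
    measurePreserving_torusSection
  have hJ : ∀ n, J ((memLp_character n).toLp (character n)) =
      UnitAddTorus.mFourierLp 2 (latticeEquiv n) := by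
    intro n
    refine (Lp.toLp_compMeasurePreserving (memLp_character n)
      measurePreserving_torusSection).trans ?_
    refine Lp.ext ((MemLp.coeFn_toLp _).trans ?_)
    refine EventuallyEq.trans ?_ (UnitAddTorus.coeFn_mFourierLp 2 _).symm
    exact ae_of_all _ fun t => (mFourier_latticeEquiv n t).symm
  have hc : ∀ n, UnitAddTorus.mFourierBasis.repr (J (hF.toLp F)) (latticeEquiv n) =
      cellCoeff F n := by
    intro n
    rw [HilbertBasis.repr_apply_apply, UnitAddTorus.coe_mFourierBasis, ← hJ,
      J.inner_map_map, L2.inner_def]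
    refine integral_congr_ae ?_
    filter_upwards [(memLp_character n).coeFn_toLp, hF.coeFn_toLp] with w h1 h2
    rw [h1, h2, RCLike.inner_apply']
  have h1 := UnitAddTorus.mFourierBasis.hasSum_repr (J (hF.toLp F))
  rw [← latticeEquiv.hasSum_iff] at h1
  have h2 : HasSum (fun n => cellCoeff F n • (memLp_character n).toLp (character n))
      (hF.toLp F) := by
    rw [← J.isometry.isUniformInducing.isInducing.hasSum_iff]
    convert! h1 using 1
    ext1 n
    simp only [Function.comp_apply, map_smul, hJ, hc, UnitAddTorus.coe_mFourierBasis]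
  refine ⟨h2, hasSum_norm_sq_of_orthonormal ?_ h2⟩
  have h3 : Orthonormal ℂ (fun n => J ((memLp_character n).toLp (character n))) := by
    simp only [hJ]
    exact UnitAddTorus.orthonormal_mFourier.comp _ latticeEquiv.injective
  exact (J.orthonormal_comp_iff).1 h3

theorem norm_toLp_sq {α : Type*} [MeasurableSpace α] {μ : Measure α} {F : α → ℂ}
    (hF : MemLp F 2 μ) : ‖hF.toLp F‖ ^ 2 = ∫ w, ‖F w‖ ^ 2 ∂μ := by
  have h := L2.inner_def (𝕜 := ℂ) (hF.toLp F) (hF.toLp F)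
  have h1 : ∫ w, inner ℂ (hF.toLp F w) (hF.toLp F w) ∂μ = ∫ w, ((‖F w‖ ^ 2 : ℝ) : ℂ) ∂μ := by
    refine integral_congr_ae ?_
    filter_upwards [hF.coeFn_toLp] with w hw
    rw [hw, inner_self_eq_norm_sq_to_K]
    simp
  rw [h1, integral_complex_ofReal, inner_self_eq_norm_sq_to_K] at h
  exact Complex.ofReal_injective (by simpa using h)

/-- The Fourier series of a square integrable function on the unit square converges in the mean. -/
theorem tendsto_integral_norm_sq_sub_fourier_sum {F : ℝ × ℝ → ℂ}
    (hF : MemLp F 2 (volume.restrict cell)) :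
    Tendsto (fun s : Finset (ℤ × ℤ) =>
      ∫ w in cell, ‖F w - ∑ n ∈ s, cellCoeff F n * character n w‖ ^ 2) atTop (𝓝 0) := by
  have h := (hasSum_fourier_cell hF).1
  have h1 := ((tendsto_const_nhds (x := hF.toLp F)).sub h).norm.pow 2
  rw [sub_self, norm_zero, zero_pow two_ne_zero] at h1
  refine h1.congr fun s => ?_
  have hs : MemLp (fun w => ∑ n ∈ s, cellCoeff F n * character n w) 2 (volume.restrict cell) :=
    memLp_finsetSum s fun n _ => (memLp_character n).const_mul _
  have e : hF.toLp F - ∑ n ∈ s, cellCoeff F n • (memLp_character n).toLp (character n) =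
      (hF.sub hs).toLp _ := by
    rw [MemLp.toLp_sub hF hs]
    congr 1
    refine Lp.ext ?_
    refine (Lp.coeFn_finsetSum _ _).trans (EventuallyEq.trans ?_ (MemLp.coeFn_toLp hs).symm)
    have : ∀ n : ℤ × ℤ, (cellCoeff F n • (memLp_character n).toLp (character n) :
        Lp ℂ 2 (volume.restrict cell)) =ᵐ[volume.restrict cell]
        fun w => cellCoeff F n * character n w := fun n => by
      filter_upwards [Lp.coeFn_smul (cellCoeff F n) ((memLp_character n).toLp (character n)),
        (memLp_character n).coeFn_toLp] with w h1 h2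
      rw [h1, Pi.smul_apply, h2, smul_eq_mul]
    filter_upwards [ae_all_iff.2 this] with w hw
    simp [hw]
  rw [e, norm_toLp_sq]
  rfl

/-! ### Fourier inversion and reconstruction from the Gabor transform -/

open scoped FourierTransform

theorem integral_fourier_mul_eq {A B : ℝ → ℂ} (hA : Integrable A) (hB : Integrable B) :
    ∫ x, 𝓕 A x * B x = ∫ x, A x * 𝓕 B x := by
  have h := VectorFourier.integral_fourierIntegral_smul_eq_flip (L := innerₗ ℝ)
    Real.continuous_fourierChar continuous_inner hA hB
  simpa using! h

theorem continuous_fourier_of_integrable {A : ℝ → ℂ} (hA : Integrable A) : Continuous (𝓕 A) :=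
  VectorFourier.fourierIntegral_continuous Real.continuous_fourierChar
    (by exact continuous_inner) hA

/-- Almost everywhere Fourier inversion for integrable functions with integrable transform. -/
theorem ae_eq_fourierInv_fourier {f : ℝ → ℂ} (hf : Integrable f) (hF : Integrable (𝓕 f)) :
    f =ᵐ[volume] 𝓕⁻ (𝓕 f) := by
  have hcont : Continuous (𝓕⁻ (𝓕 f)) := by
    have : 𝓕⁻ (𝓕 f) = fun x => 𝓕 (𝓕 f) (-x) := funext fun x => Real.fourierInv_eq_fourier_neg _ x
    rw [this]
    exact (continuous_fourier_of_integrable hF).comp continuous_neg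
  have h0 : ∀ᵐ x, f x - 𝓕⁻ (𝓕 f) x = 0 := by
    -- Tested against a smooth compactly supported `G`, both sides equal `∫ 𝓕⁻ G · 𝓕 f` by the
    -- multiplication formula; inversion is used only for the Schwartz function `G`.
    refine ae_eq_zero_of_integral_contDiff_smul_eq_zero
      (hf.locallyIntegrable.sub hcont.locallyIntegrable) fun g hg hgc => ?_
    have hgc' : HasCompactSupport fun x => (g x : ℂ) := hgc.comp_left Complex.ofReal_zero
    let G : SchwartzMap ℝ ℂ := hgc'.toSchwartzMap (Complex.ofRealCLM.contDiff.comp hg)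
    have hG : ∀ x, G x = g x := fun x => rfl
    let H : SchwartzMap ℝ ℂ := 𝓕⁻ G
    have hHG : 𝓕 (H : ℝ → ℂ) = G := by
      rw [← SchwartzMap.fourier_coe, FourierTransform.fourier_fourierInv_eq]
    have hH : ∀ x, H x = 𝓕 (G : ℝ → ℂ) (-x) := fun x => by
      rw [← Real.fourierInv_eq_fourier_neg, ← SchwartzMap.fourierInv_coe]
    have e1 : ∫ x, G x * f x = ∫ x, H x * 𝓕 f x := by
      rw [← hHG]; exact integral_fourier_mul_eq H.integrable hf
    have e2 : ∫ x, G x * 𝓕⁻ (𝓕 f) x = ∫ x, H x * 𝓕 f x := by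
      rw [← integral_neg_eq_self (fun x => H x * 𝓕 f x)]
      have hn : Integrable fun x => 𝓕 f (-x) := hF.comp_neg
      have h3 := integral_fourier_mul_eq G.integrable hn
      simp only [hH, neg_neg]
      rw [h3]
      refine integral_congr_ae (ae_of_all _ fun x => ?_)
      simp only
      congr 1
      rw [Real.fourierInv_eq_fourier_comp_neg]
    have i1 : Integrable fun x => G x * f x := by
      refine hf.bdd_mul (c := ‖G.toBoundedContinuousFunction‖)
        G.continuous.aestronglyMeasurable (ae_of_all _ fun x => ?_)
      exact G.toBoundedContinuousFunction.norm_coe_le_norm x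
    have i2 : Integrable fun x => G x * 𝓕⁻ (𝓕 f) x :=
      (G.continuous.mul hcont).integrable_of_hasCompactSupport hgc'.mul_right
    calc ∫ x, g x • (f x - 𝓕⁻ (𝓕 f) x) = ∫ x, (G x * f x - G x * 𝓕⁻ (𝓕 f) x) := by
          refine integral_congr_ae (ae_of_all _ fun x => ?_)
          simp only [hG, Complex.real_smul, mul_sub]
      _ = 0 := by rw [integral_sub i1 i2, e1, e2, sub_self]
  filter_upwards [h0] with x hx
  exact sub_eq_zero.1 hx

/-- The superposition `∫ A(l) e_l dl` of Gabor functions. -/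
def synthesis (A : ℝ × ℝ → ℂ) (x : ℝ) : ℂ := ∫ l, A l * gaborFun l x

theorem norm_gaborFun_le_two (l : ℝ × ℝ) (x : ℝ) : ‖gaborFun l x‖ ≤ 2 := by
  rw [norm_gaborFun]
  have h1 : Real.exp (-Real.pi * (x - l.1) ^ 2) ≤ 1 := by
    rw [Real.exp_le_one_iff]
    nlinarith [Real.pi_pos, sq_nonneg (x - l.1)]
  calc _ ≤ (2 : ℝ) * 1 := by gcongr; exact rpow_quarter_le
    _ = 2 := mul_one 2

theorem continuous_gaborFun_left (x : ℝ) : Continuous fun l => gaborFun l x := by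
  unfold gaborFun; fun_prop

theorem integrable_mul_gaborFun {A : ℝ × ℝ → ℂ} (hA : Integrable A) (x : ℝ) :
    Integrable fun l => A l * gaborFun l x :=
  hA.mul_bdd (continuous_gaborFun_left x).aestronglyMeasurable
    (ae_of_all _ fun l => norm_gaborFun_le_two l x)

theorem continuous_synthesis {A : ℝ × ℝ → ℂ} (hA : Integrable A) : Continuous (synthesis A) := by
  refine continuous_of_dominated (bound := fun l => ‖A l‖ * 2)
    (fun x => (integrable_mul_gaborFun hA x).aestronglyMeasurable)
    (fun x => ae_of_all _ fun l => ?_) (hA.norm.mul_const 2) (ae_of_all _ fun l => ?_)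
  · rw [norm_mul]
    exact mul_le_mul_of_nonneg_left (norm_gaborFun_le_two l x) (norm_nonneg _)
  · unfold gaborFun; fun_prop

/-- The coset bound for `gaborFun l` is uniform in `l`, so it passes through the integral. This
controls both the superposition and the exchange of sum and integral in `zak_synthesis`. -/
theorem sum_integral_norm_le {A : ℝ × ℝ → ℂ} (hA : Integrable A) {M : ℝ}
    (hM : ∀ l, IsWiener (gaborFun l) M) (y : ℝ) (s : Finset ℤ) :
    ∑ q ∈ s, ∫ l, ‖A l * gaborFun l (y + q)‖ ≤ M * ∫ l, ‖A l‖ := by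
  rw [← integral_finsetSum s fun q _ => (integrable_mul_gaborFun hA (y + q)).norm,
    ← integral_const_mul]
  refine integral_mono (integrable_finsetSum s fun q _ =>
    (integrable_mul_gaborFun hA (y + q)).norm) (hA.norm.const_mul M) fun l => ?_
  simp only [norm_mul]
  rw [← Finset.mul_sum, mul_comm]
  gcongr
  exact (((hM l).summable y).sum_le_tsum s fun _ _ => norm_nonneg _).trans ((hM l).tsum_le y)

theorem summable_integral_norm {A : ℝ × ℝ → ℂ} (hA : Integrable A) (y : ℝ) :
    Summable fun q : ℤ => ∫ l, ‖A l * gaborFun l (y + q)‖ := by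
  obtain ⟨M, -, hM⟩ := exists_isWiener_gaborFun
  exact summable_of_sum_le (fun q => integral_nonneg fun l => norm_nonneg _)
    (sum_integral_norm_le hA hM y)

theorem isWiener_synthesis {A : ℝ × ℝ → ℂ} (hA : Integrable A) {M : ℝ}
    (hM : ∀ l, IsWiener (gaborFun l) M) : IsWiener (synthesis A) (M * ∫ l, ‖A l‖) := by
  have hs : ∀ y : ℝ, Summable fun q : ℤ => ‖synthesis A (y + q)‖ := fun y =>
    Summable.of_nonneg_of_le (fun _ => norm_nonneg _) (fun q => norm_integral_le_integral_norm _)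
      (summable_integral_norm hA y)
  refine ⟨continuous_synthesis hA, hs, fun y => ?_⟩
  refine ((hs y).tsum_le_tsum (fun q => norm_integral_le_integral_norm _)
      (summable_integral_norm hA y)).trans ?_
  exact (summable_integral_norm hA y).tsum_le_of_sum_le (sum_integral_norm_le hA hM y)

theorem zak_synthesis {A : ℝ × ℝ → ℂ} (hA : Integrable A) (w : ℝ × ℝ) :
    zak (synthesis A) w = ∫ l, A l * zak (gaborFun l) w := by
  have hn : ∀ (q : ℤ) l, ‖A l * zakTerm (gaborFun l) w q‖ = ‖A l * gaborFun l (w.1 + q)‖ :=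
    fun q l => by rw [norm_mul, norm_mul, norm_zakTerm]
  have hi : ∀ q : ℤ, Integrable fun l => A l * zakTerm (gaborFun l) w q := fun q => by
    have := (integrable_mul_gaborFun hA (w.1 + q)).mul_const
      (Complex.exp (-(2 * Real.pi * Complex.I * q * w.2)))
    simpa only [zakTerm, mul_assoc] using this
  have h := hasSum_integral_of_summable_integral_norm hi
    (by simpa only [hn] using summable_integral_norm hA w.1)
  simp only [tsum_mul_left] at h
  rw [zak]
  refine Eq.trans (tsum_congr fun q => ?_) h.tsum_eq
  rw [zakTerm, synthesis, ← integral_mul_const]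
  simp only [zakTerm, mul_assoc]

/-- The Gaussian window. -/
def window (x : ℝ) : ℝ := 2 ^ (1 / 4 : ℝ) * Real.exp (-Real.pi * x ^ 2)

theorem gaborFun_eq (l : ℝ × ℝ) (x : ℝ) :
    gaborFun l x = window (x - l.1) * Complex.exp (2 * Real.pi * Complex.I * l.2 * x) := by
  rw [gaborFun, window, Complex.exp_add]
  push_cast
  ring

theorem continuous_window : Continuous window := by unfold window; fun_prop

theorem integral_window_sq : ∫ x, window x ^ 2 = 1 := by
  have e : ∀ x, window x ^ 2 = √2 * Real.exp (-(2 * Real.pi) * x ^ 2) := by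
    intro x
    rw [window, mul_pow, ← Real.exp_nat_mul, ← Real.rpow_natCast, ← Real.rpow_mul (by norm_num),
      Real.sqrt_eq_rpow]
    norm_num
    ring
  simp only [e]
  rw [integral_const_mul, integral_gaussian, ← Real.sqrt_mul (by norm_num)]
  have : (2 : ℝ) * (Real.pi / (2 * Real.pi)) = 1 := by field_simp
  rw [this, Real.sqrt_one]

theorem memLp_window : MemLp window 2 volume := by
  rw [memLp_two_iff_integrable_sq continuous_window.aestronglyMeasurable]
  exact integrable_of_integral_eq_one integral_window_sq

theorem gaborTransform_eq_fourier (f : L2) (p θ : ℝ) :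
    gaborTransform f (p, θ) = 𝓕 (fun x => f x * window (x - p)) θ := by
  rw [gaborTransform_eq_integral, Real.fourier_real_eq_integral_exp_smul]
  refine integral_congr_ae (ae_of_all _ fun x => ?_)
  simp only [smul_eq_mul]
  rw [gaborFun_eq, map_mul, Complex.conj_ofReal, ← Complex.exp_conj]
  have : (starRingEnd ℂ) (2 * Real.pi * Complex.I * θ * x) =
      ((-2 * Real.pi * x * θ : ℝ) : ℂ) * Complex.I := by
    simp only [map_mul, Complex.conj_ofReal, Complex.conj_I, Complex.conj_ofNat]
    push_cast; ring
  rw [this]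
  ring

theorem integrable_mul_window (f : L2) (p : ℝ) : Integrable fun x => f x * window (x - p) := by
  have h1 : MemLp (fun x => (window (x - p) : ℂ)) 2 volume :=
    (memLp_window.comp_measurePreserving (measurePreserving_sub_right volume p)).ofReal
  exact (Lp.memLp f).integrable_mul h1

/-- Reconstruction of `f` from its Gabor transform. -/
theorem ae_eq_synthesis (f : L2) (hA : Integrable (gaborTransform f)) :
    f =ᵐ[volume] synthesis (gaborTransform f) := by
  -- For fixed `p` the Gabor transform is the Fourier transform of `f · window(· - p)`. Inversion in
  -- `θ` gives `f · window(· - p)²`, and `∫ window² = 1` will remove the window.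
  have h1 : ∀ᵐ p, ∀ᵐ x, f x * window (x - p) * window (x - p) =
      ∫ θ, gaborTransform f (p, θ) * gaborFun (p, θ) x := by
    filter_upwards [hA.prod_right_ae] with p hp
    have e : (fun θ => gaborTransform f (p, θ)) = 𝓕 (fun x => f x * window (x - p)) :=
      funext fun θ => gaborTransform_eq_fourier f p θ
    rw [e] at hp
    filter_upwards [ae_eq_fourierInv_fourier (integrable_mul_window f p) hp] with x hx
    rw [hx, Real.fourierInv_eq', ← integral_mul_const]
    refine integral_congr_ae (ae_of_all _ fun θ => ?_)
    simp only [smul_eq_mul]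
    rw [gaborFun_eq, ← gaborTransform_eq_fourier]
    simp only [RCLike.inner_apply, conj_trivial]
    push_cast
    ring_nf
  -- Exchanging "almost every `p`" and "almost every `x`" requires a measurable set in the plane.
  have hm : MeasurableSet {z : ℝ × ℝ | f z.2 * window (z.2 - z.1) * window (z.2 - z.1) =
      ∫ θ, gaborTransform f (z.1, θ) * gaborFun (z.1, θ) z.2} := by
    refine measurableSet_eq_fun ?_ ?_
    · have := (Lp.stronglyMeasurable f).measurable
      have := continuous_window.measurable
      fun_prop
    · refine (StronglyMeasurable.integral_prod_right (f := fun (z : ℝ × ℝ) θ =>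
        gaborTransform f (z.1, θ) * gaborFun (z.1, θ) z.2) ?_).measurable
      refine StronglyMeasurable.mul ?_ ?_
      · exact (stronglyMeasurable_gaborTransform f).comp_measurable
          (by fun_prop : Measurable fun u : (ℝ × ℝ) × ℝ => (u.1.1, u.2))
      · exact (continuous_gaborFun_uncurry.comp
          (by fun_prop : Continuous fun u : (ℝ × ℝ) × ℝ => ((u.1.1, u.2), u.1.2))).stronglyMeasurable
  filter_upwards [(Measure.ae_ae_comm hm).1 h1] with x hx
  rw [synthesis, Measure.volume_eq_prod, integral_prod _ (integrable_mul_gaborFun hA x),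
    ← integral_congr_ae hx]
  have e : ∀ p, f x * window (x - p) * window (x - p) = f x * ((window (x - p) ^ 2 : ℝ) : ℂ) :=
    fun p => by push_cast; ring
  simp only [e]
  rw [integral_const_mul, integral_complex_ofReal, integral_sub_left_eq_self (fun p => window p ^ 2),
    integral_window_sq]
  simp

/-! ### Weighted integrability of the Gabor transform -/

theorem growth_le (l : ℝ × ℝ) : growth l ≤ 2 * (1 + ‖l‖) := by
  have h1 : |l.1| ≤ ‖l‖ := norm_fst_le l
  have h2 : |l.2| ≤ ‖l‖ := norm_snd_le l
  unfold growth
  linarith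

theorem norm_le_euclid (l : ℝ × ℝ) : ‖l‖ ≤ euclid l := by
  rw [Prod.norm_def, euclid]
  refine max_le ?_ ?_ <;> refine Real.abs_le_sqrt ?_ <;> nlinarith [sq_nonneg l.1, sq_nonneg l.2]

theorem weight_pos (δ : ℝ) (l : ℝ × ℝ) : 0 < weight δ l := by
  have : 0 ≤ euclid l ^ δ := Real.rpow_nonneg (Real.sqrt_nonneg _) _
  unfold weight; linarith

theorem rpow_one_add_norm_le_weight {δ : ℝ} (hδ : 0 ≤ δ) (l : ℝ × ℝ) :
    (1 + ‖l‖) ^ δ ≤ 2 ^ δ * weight δ l := by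
  have h0 : 0 ≤ euclid l := Real.sqrt_nonneg _
  have h1 : (1 + ‖l‖) ≤ 2 * max 1 (euclid l) := by
    have := norm_le_euclid l
    have := le_max_left 1 (euclid l)
    have := le_max_right 1 (euclid l)
    linarith
  calc (1 + ‖l‖) ^ δ ≤ (2 * max 1 (euclid l)) ^ δ := by gcongr
    _ = 2 ^ δ * (max 1 (euclid l)) ^ δ := Real.mul_rpow (by norm_num) (by positivity)
    _ ≤ 2 ^ δ * weight δ l := by
      gcongr
      have := Real.rpow_nonneg h0 δ
      unfold weight
      rcases max_cases 1 (euclid l) with h | h <;> rw [h.1]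
      · rw [Real.one_rpow]; linarith
      · linarith

theorem growth_rpow_div_weight_le {δ α : ℝ} (hδ : 0 ≤ δ) (hα : 0 ≤ α) (l : ℝ × ℝ) :
    growth l ^ α / weight δ l ≤ 2 ^ α * 2 ^ δ * (1 + ‖l‖) ^ (-(δ - α)) := by
  have h0 : 0 < 1 + ‖l‖ := by positivity
  rw [div_le_iff₀ (weight_pos δ l)]
  have h1 : growth l ^ α ≤ 2 ^ α * (1 + ‖l‖) ^ α := by
    rw [← Real.mul_rpow (by norm_num) h0.le]
    exact Real.rpow_le_rpow (zero_le_one.trans (one_le_growth l)) (growth_le l) hα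
  have h2 : (1 + ‖l‖) ^ α = (1 + ‖l‖) ^ (-(δ - α)) * (1 + ‖l‖) ^ δ := by
    rw [← Real.rpow_add h0]; congr 1; ring
  calc growth l ^ α ≤ 2 ^ α * ((1 + ‖l‖) ^ (-(δ - α)) * (1 + ‖l‖) ^ δ) := by rwa [← h2]
    _ ≤ 2 ^ α * ((1 + ‖l‖) ^ (-(δ - α)) * (2 ^ δ * weight δ l)) := by
      gcongr; exact rpow_one_add_norm_le_weight hδ l
    _ = _ := by ring

theorem measurable_growth : Measurable growth := by unfold growth; fun_prop

/-- The square decays like `(1 + ‖l‖)^(-2(δ - α))`, which is integrable over the plane when `2(δ -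
α) > 2`. The threshold `δ > 1` comes from here. -/
theorem memLp_growth_rpow_div_weight {δ α : ℝ} (hδ : 0 ≤ δ) (hα : 0 ≤ α) (h : 1 < δ - α) :
    MemLp (fun l => growth l ^ α / weight δ l) 2 volume := by
  have hm : Measurable fun l => growth l ^ α / weight δ l :=
    (measurable_growth.pow_const α).div (measurable_weight δ)
  rw [memLp_two_iff_integrable_sq hm.aestronglyMeasurable]
  have hi : Integrable (fun l : ℝ × ℝ => (1 + ‖l‖) ^ (-(2 * (δ - α)))) :=
    integrable_one_add_norm (by simp; linarith)
  refine (hi.const_mul ((2 ^ α * 2 ^ δ) ^ 2)).mono' (hm.pow_const 2).aestronglyMeasurable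
    (ae_of_all _ fun l => ?_)
  have h0 : 0 < 1 + ‖l‖ := by positivity
  have hg : 0 ≤ growth l ^ α / weight δ l :=
    div_nonneg (Real.rpow_nonneg (zero_le_one.trans (one_le_growth l)) _) (weight_pos δ l).le
  rw [Real.norm_of_nonneg (sq_nonneg _)]
  have e : (1 + ‖l‖) ^ (-(2 * (δ - α))) = ((1 + ‖l‖) ^ (-(δ - α))) ^ 2 := by
    rw [← Real.rpow_natCast, ← Real.rpow_mul h0.le]; congr 1; push_cast; ring
  rw [e, ← mul_pow]
  exact pow_le_pow_left₀ hg (growth_rpow_div_weight_le hδ hα l) 2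

theorem gaborNorm_nonneg (δ : ℝ) (f : L2) : 0 ≤ gaborNorm δ f := Real.sqrt_nonneg _

/-- Weighted integrability of the Gabor transform of an element of `H^δ`. -/
theorem exists_integral_growth_le {δ α : ℝ} (hα : 0 ≤ α) (h : 1 < δ - α) :
    ∃ C : ℝ, 0 ≤ C ∧ ∀ f ∈ gaborSpace δ,
      Integrable (fun l => ‖gaborTransform f l‖ * growth l ^ α) ∧
      ∫ l, ‖gaborTransform f l‖ * growth l ^ α ≤ C * gaborNorm δ f := by
  have hr := memLp_growth_rpow_div_weight (δ := δ) (by linarith) hα h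
  refine ⟨√(∫ l, (growth l ^ α / weight δ l) ^ 2), Real.sqrt_nonneg _, fun f hf => ?_⟩
  have hA : MemLp (fun l => weight δ l * ‖gaborTransform f l‖) 2 volume := by
    have := ((finiteGaborNorm_iff δ f).1 hf).norm
    simpa [abs_of_pos (weight_pos δ _)] using this
  have e : ∀ l, ‖gaborTransform f l‖ * growth l ^ α =
      (weight δ l * ‖gaborTransform f l‖) * (growth l ^ α / weight δ l) := fun l => by
    have := (weight_pos δ l).ne'
    field_simp
  have hpos : ∀ l, 0 ≤ growth l ^ α / weight δ l := fun l =>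
    div_nonneg (Real.rpow_nonneg (zero_le_one.trans (one_le_growth l)) _) (weight_pos δ l).le
  simp only [e]
  refine ⟨hA.integrable_mul hr, ?_⟩
  -- Cauchy–Schwarz: one factor has norm `gaborNorm δ f`, the other is the fixed function whose `L₂`
  -- norm was chosen as the constant.
  have := integral_mul_le_Lp_mul_Lq_of_nonneg (μ := volume) Real.HolderConjugate.two_two
    (f := fun l => weight δ l * ‖gaborTransform f l‖)
    (g := fun l => growth l ^ α / weight δ l)
    (ae_of_all _ fun l => mul_nonneg (weight_pos δ l).le (norm_nonneg _)) (ae_of_all _ hpos)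
    (by simpa using hA) (by simpa using hr)
  refine this.trans_eq ?_
  rw [gaborNorm, mul_comm, ← Real.sqrt_eq_rpow, ← Real.sqrt_eq_rpow]
  simp only [Real.rpow_two, mul_pow]

theorem integrable_gaborTransform {δ : ℝ} (hδ : 1 < δ) {f : L2} (hf : f ∈ gaborSpace δ) :
    Integrable (gaborTransform f) := by
  obtain ⟨C, -, h⟩ := exists_integral_growth_le (δ := δ) le_rfl (by linarith)
  have := (h f hf).1
  simp only [Real.rpow_zero, mul_one] at this
  exact (integrable_norm_iff (stronglyMeasurable_gaborTransform f).aestronglyMeasurable).1 this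

theorem exists_integral_norm_le {δ : ℝ} (hδ : 1 < δ) :
    ∃ C : ℝ, 0 ≤ C ∧ ∀ f ∈ gaborSpace δ, ∫ l, ‖gaborTransform f l‖ ≤ C * gaborNorm δ f := by
  obtain ⟨C, hC, h⟩ := exists_integral_growth_le (δ := δ) le_rfl (by linarith)
  exact ⟨C, hC, fun f hf => by simpa using (h f hf).2⟩

/-! ### Hölder continuity at the centre -/

/-- Interpolation in `t = ‖w - centre‖ * growth l`: the Lipschitz bound and `t ≤ t^α` serve for `t ≤
1`, the uniform bound and `1 ≤ t^α` for `t ≥ 1`. -/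
theorem exists_hoelder_zak_gaborFun : ∃ K : ℝ, 0 < K ∧ ∀ α : ℝ, 0 ≤ α → α ≤ 1 → ∀ l,
    ∀ w ∈ unitSquare, ‖zak (gaborFun l) w - zak (gaborFun l) centre‖ ≤
      K * ‖w - centre‖ ^ α * growth l ^ α := by
  obtain ⟨M, hM, hW⟩ := exists_isWiener_gaborFun
  obtain ⟨C, hC, hL⟩ := exists_lipschitz_zak_gaborFun
  refine ⟨2 * M + C, by positivity, fun α hα hα1 l w hw => ?_⟩
  have hg := one_le_growth l
  set t := ‖w - centre‖ * growth l with ht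
  have ht0 : 0 ≤ t := by positivity
  rw [mul_assoc, ← Real.mul_rpow (norm_nonneg _) (by linarith), ← ht]
  rcases le_total t 1 with h1 | h1
  · calc _ ≤ C * growth l * ‖w - centre‖ := hL l w hw
      _ = C * t := by rw [ht]; ring
      _ ≤ C * t ^ α := by
        gcongr
        exact Real.self_le_rpow_of_le_one ht0 h1 hα1
      _ ≤ _ := by gcongr; linarith
  · calc _ ≤ ‖zak (gaborFun l) w‖ + ‖zak (gaborFun l) centre‖ := norm_sub_le _ _
      _ ≤ M + M := add_le_add ((hW l).norm_zak_le w) ((hW l).norm_zak_le centre)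
      _ = 2 * M * 1 := by ring
      _ ≤ (2 * M + C) * t ^ α := by
        gcongr
        · linarith
        · exact Real.one_le_rpow h1 hα

theorem measurable_zak_gaborFun_left (w : ℝ × ℝ) :
    Measurable fun l => zak (gaborFun l) w := by
  obtain ⟨M, -, hW⟩ := exists_isWiener_gaborFun
  refine measurable_of_tendsto_metrizable' (atTop : Filter (Finset ℤ))
    (f := fun s l => ∑ q ∈ s, zakTerm (gaborFun l) w q) (fun s => ?_)
    (tendsto_pi_nhds.2 fun l => ((hW l).summable_zakTerm w).hasSum)
  refine Finset.measurable_sum _ fun q _ => ?_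
  unfold zakTerm
  exact ((continuous_gaborFun_left _).mul continuous_const).measurable

theorem integrable_mul_zak_gaborFun {A : ℝ × ℝ → ℂ} (hA : Integrable A) (w : ℝ × ℝ) :
    Integrable fun l => A l * zak (gaborFun l) w := by
  obtain ⟨M, -, hW⟩ := exists_isWiener_gaborFun
  exact hA.mul_bdd (measurable_zak_gaborFun_left w).aestronglyMeasurable
    (ae_of_all _ fun l => (hW l).norm_zak_le w)

/-- The Zak transforms of the elements of `H^δ` are Hölder continuous at the centre. -/
theorem exists_hoelder_zak_synthesis {δ α : ℝ} (hα : 0 ≤ α) (hα1 : α ≤ 1) (h : 1 < δ - α) :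
    ∃ C : ℝ, 0 ≤ C ∧ ∀ f ∈ gaborSpace δ, ∀ w ∈ unitSquare,
      ‖zak (synthesis (gaborTransform f)) w - zak (synthesis (gaborTransform f)) centre‖ ≤
        C * gaborNorm δ f * ‖w - centre‖ ^ α := by
  obtain ⟨K, hK, hz⟩ := exists_hoelder_zak_gaborFun
  obtain ⟨C, hC, hf⟩ := exists_integral_growth_le hα h
  refine ⟨K * C, by positivity, fun f hfδ w hw => ?_⟩
  have hA := integrable_gaborTransform (by linarith) hfδ
  obtain ⟨h1, h2⟩ := hf f hfδ
  rw [zak_synthesis hA, zak_synthesis hA, ← integral_sub (integrable_mul_zak_gaborFun hA w)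
    (integrable_mul_zak_gaborFun hA centre)]
  calc _ ≤ ∫ l, K * ‖w - centre‖ ^ α * (‖gaborTransform f l‖ * growth l ^ α) := by
        refine norm_integral_le_of_norm_le (h1.const_mul _) (ae_of_all _ fun l => ?_)
        rw [← mul_sub, norm_mul]
        have := mul_le_mul_of_nonneg_left (hz α hα hα1 l w hw) (norm_nonneg (gaborTransform f l))
        linarith
    _ = K * ‖w - centre‖ ^ α * ∫ l, ‖gaborTransform f l‖ * growth l ^ α := integral_const_mul _ _
    _ ≤ K * ‖w - centre‖ ^ α * (C * gaborNorm δ f) := by gcongr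
    _ = _ := by ring

/-! ### Square integrability of the quotient -/

theorem integrableOn_abs_sub_rpow {r : ℝ} (hr : -1 < r) :
    IntegrableOn (fun y : ℝ => |y - 1 / 2| ^ r) (Set.Ioc 0 1) := by
  have h1 : IntervalIntegrable (fun x : ℝ => |x| ^ r) volume 0 (1 / 2) := by
    refine (intervalIntegral.intervalIntegrable_rpow' hr).congr fun x hx => ?_
    rw [Set.uIoc_of_le (by norm_num)] at hx
    simp only [abs_of_pos hx.1]
  have h2 : IntervalIntegrable (fun x : ℝ => |x| ^ r) volume (-(1 / 2)) 0 := by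
    have := ((IntervalIntegrable.iff_comp_neg (by simp)).1 h1).symm
    simpa only [abs_neg, neg_zero] using this
  have h3 := (h2.trans h1).comp_sub_right (1 / 2)
  rw [show -(1 / 2) + 1 / 2 = (0 : ℝ) by norm_num, show 1 / 2 + 1 / 2 = (1 : ℝ) by norm_num,
    intervalIntegrable_iff_integrableOn_Ioc_of_le zero_le_one] at h3
  exact h3

/-- The sup norm dominates both coordinates, so for `r ≤ 0` the square is at most a product of
one-variable powers, each integrable because `r > -1`. -/
theorem integrableOn_norm_sub_centre_rpow {r : ℝ} (hr : -1 < r) (hr0 : r ≤ 0) :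
    IntegrableOn (fun w : ℝ × ℝ => (‖w - centre‖ ^ r) ^ 2) cell := by
  have hp : Integrable (fun w : ℝ × ℝ => |w.1 - 1 / 2| ^ r * |w.2 - 1 / 2| ^ r)
      (volume.restrict cell) := by
    rw [volume_restrict_cell]
    exact Integrable.mul_prod (integrableOn_abs_sub_rpow hr) (integrableOn_abs_sub_rpow hr)
  have hm : Measurable fun w : ℝ × ℝ => (‖w - centre‖ ^ r) ^ 2 := by fun_prop
  have hne : ∀ᵐ y : ℝ, y ≠ 1 / 2 := by
    rw [ae_iff]; simp
  have h1 : ∀ᵐ w : ℝ × ℝ, w.1 ≠ 1 / 2 := Measure.quasiMeasurePreserving_fst.ae hne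
  have h2 : ∀ᵐ w : ℝ × ℝ, w.2 ≠ 1 / 2 := Measure.quasiMeasurePreserving_snd.ae hne
  refine hp.mono' hm.aestronglyMeasurable ?_
  filter_upwards [ae_restrict_of_ae h1, ae_restrict_of_ae h2] with w hw1 hw2
  have p1 : 0 < |w.1 - 1 / 2| := abs_pos.2 (sub_ne_zero.2 hw1)
  have p2 : 0 < |w.2 - 1 / 2| := abs_pos.2 (sub_ne_zero.2 hw2)
  rw [Real.norm_of_nonneg (sq_nonneg _), sq]
  exact mul_le_mul (Real.rpow_le_rpow_of_nonpos p1 (norm_fst_le (w - centre)) hr0)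
    (Real.rpow_le_rpow_of_nonpos p2 (norm_snd_le (w - centre)) hr0)
    (by positivity) (by positivity)

/-- The value at `f` of the sharp Poisson functional. -/
def sharpCoeff (f : L2) : ℂ :=
  1 / (Complex.I * Theta 0) * zak (synthesis (gaborTransform f)) centre

/-- The quotient of `Z(f - γ^♯(f) e_♯)` by `Z e_0`. -/
def zakQuotient (f : L2) (w : ℝ × ℝ) : ℂ :=
  (zak (synthesis (gaborTransform f)) w - sharpCoeff f * zak (gaborFun sharp) w) /
    zak (gaborFun 0) w

theorem sharpCoeff_mul (f : L2) :
    sharpCoeff f * zak (gaborFun sharp) centre = zak (synthesis (gaborTransform f)) centre := by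
  have := Theta_zero_ne_zero
  have := Complex.I_ne_zero
  rw [zak_gaborFun_sharp_centre, sharpCoeff]
  field_simp

theorem exists_norm_sharpCoeff_le {δ : ℝ} (hδ : 1 < δ) :
    ∃ C : ℝ, 0 ≤ C ∧ ∀ f ∈ gaborSpace δ, ‖sharpCoeff f‖ ≤ C * gaborNorm δ f := by
  obtain ⟨M, hM, hW⟩ := exists_isWiener_gaborFun
  obtain ⟨C, hC, h⟩ := exists_integral_norm_le hδ
  refine ⟨‖1 / (Complex.I * Theta 0)‖ * (M * C), by positivity, fun f hf => ?_⟩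
  have hA := integrable_gaborTransform hδ hf
  rw [sharpCoeff, norm_mul, mul_assoc]
  gcongr
  refine ((isWiener_synthesis hA hW).norm_zak_le centre).trans ?_
  rw [mul_assoc]
  have := h f hf
  gcongr

/-- Where `zak (gaborFun 0)` vanishes the quotient is `0` by convention. The identity survives
because the only such point is the centre, where the numerator vanishes by the choice of
`sharpCoeff`. -/
theorem zakQuotient_mul (f : L2) {w : ℝ × ℝ} (hw : w ∈ unitSquare) :
    zakQuotient f w * zak (gaborFun 0) w =
      zak (synthesis (gaborTransform f)) w - sharpCoeff f * zak (gaborFun sharp) w := by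
  obtain ⟨c, hc, h⟩ := exists_zak_gaussian_ge
  by_cases hz : zak (gaborFun 0) w = 0
  · have h1 := h w hw
    rw [hz, norm_zero] at h1
    have h2 : w = centre := by
      rw [← sub_eq_zero, ← norm_le_zero_iff]
      by_contra h3
      push Not at h3
      nlinarith
    rw [hz, mul_zero, h2, sharpCoeff_mul, sub_self]
  · rw [zakQuotient, div_mul_cancel₀ _ hz]

/-- Both parts of the numerator are Hölder of order `α` and their values at the centre cancel, while
the denominator is at least linear in the distance to the centre. -/
theorem exists_norm_zakQuotient_le {δ α : ℝ} (hα : 0 ≤ α) (hα1 : α ≤ 1) (h : 1 < δ - α) :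
    ∃ C : ℝ, 0 ≤ C ∧ ∀ f ∈ gaborSpace δ, ∀ w ∈ unitSquare,
      ‖zakQuotient f w‖ ≤ C * gaborNorm δ f * ‖w - centre‖ ^ (α - 1) := by
  obtain ⟨c, hc, hz⟩ := exists_zak_gaussian_ge
  obtain ⟨K, hK, hg⟩ := exists_hoelder_zak_gaborFun
  obtain ⟨C, hC, hs⟩ := exists_hoelder_zak_synthesis hα hα1 h
  obtain ⟨D, hD, hd⟩ := exists_norm_sharpCoeff_le (δ := δ) (by linarith)
  have hgs := one_le_growth sharp
  refine ⟨(C + D * (K * growth sharp ^ α)) / c, by positivity, fun f hf w hw => ?_⟩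
  have hN := gaborNorm_nonneg δ f
  by_cases hwc : w = centre
  · rw [zakQuotient, hwc, sharpCoeff_mul, sub_self, zero_div, norm_zero]
    positivity
  have hpos : 0 < ‖w - centre‖ := norm_pos_iff.2 (sub_ne_zero.2 hwc)
  have e : zak (synthesis (gaborTransform f)) w - sharpCoeff f * zak (gaborFun sharp) w =
      (zak (synthesis (gaborTransform f)) w - zak (synthesis (gaborTransform f)) centre) -
      sharpCoeff f * (zak (gaborFun sharp) w - zak (gaborFun sharp) centre) := by
    rw [mul_sub, sharpCoeff_mul]; ring
  have h1 : ‖zak (synthesis (gaborTransform f)) w - sharpCoeff f * zak (gaborFun sharp) w‖ ≤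
      (C + D * (K * growth sharp ^ α)) * gaborNorm δ f * ‖w - centre‖ ^ α := by
    rw [e]
    refine (norm_sub_le _ _).trans ?_
    rw [norm_mul]
    have h2 := hs f hf w hw
    have h3 := mul_le_mul (hd f hf) (hg α hα hα1 sharp w hw) (norm_nonneg _) (by positivity)
    linarith
  rw [zakQuotient, norm_div, div_le_iff₀ (lt_of_lt_of_le (by positivity) (hz w hw))]
  refine h1.trans ?_
  have e2 : ‖w - centre‖ ^ α = ‖w - centre‖ ^ (α - 1) * ‖w - centre‖ := by
    rw [Real.rpow_sub_one hpos.ne', div_mul_cancel₀ _ hpos.ne']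
  calc _ = (C + D * (K * growth sharp ^ α)) / c * gaborNorm δ f * ‖w - centre‖ ^ (α - 1) *
        (c * ‖w - centre‖) := by rw [e2]; field_simp
    _ ≤ _ := by gcongr; exact hz w hw

theorem measurable_zakQuotient {f : L2} (hA : Integrable (gaborTransform f)) :
    Measurable (zakQuotient f) := by
  obtain ⟨M, -, hW⟩ := exists_isWiener_gaborFun
  exact ((isWiener_synthesis hA hW).measurable_zak.sub
    ((hW sharp).measurable_zak.const_mul _)).div (hW 0).measurable_zak

theorem exists_integral_norm_sq_zakQuotient_le {δ : ℝ} (hδ : 1 < δ) :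
    ∃ C : ℝ, 0 ≤ C ∧ ∀ f ∈ gaborSpace δ, MemLp (zakQuotient f) 2 (volume.restrict cell) ∧
      ∫ w in cell, ‖zakQuotient f w‖ ^ 2 ≤ C * gaborNorm δ f ^ 2 := by
  obtain ⟨α, hα0, hα1, hα⟩ : ∃ α : ℝ, 0 < α ∧ α ≤ 1 ∧ 1 < δ - α := by
    -- Any `α` with `0 < α ≤ 1` and `α < δ - 1` would do; positivity makes `α - 1 > -1`.
    refine ⟨min 1 ((δ - 1) / 2), lt_min one_pos (by linarith), min_le_left _ _, ?_⟩
    have := min_le_right 1 ((δ - 1) / 2)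
    linarith
  obtain ⟨C, hC, h⟩ := exists_norm_zakQuotient_le hα0.le hα1 hα
  have hi := integrableOn_norm_sub_centre_rpow (r := α - 1) (by linarith) (by linarith)
  refine ⟨C ^ 2 * ∫ w in cell, (‖w - centre‖ ^ (α - 1)) ^ 2,
    mul_nonneg (sq_nonneg C) (integral_nonneg fun w => sq_nonneg _), fun f hf => ?_⟩
  have hm := (measurable_zakQuotient (integrable_gaborTransform hδ hf))
  have hb : ∀ᵐ w ∂volume.restrict cell, ‖zakQuotient f w‖ ^ 2 ≤
      C ^ 2 * gaborNorm δ f ^ 2 * (‖w - centre‖ ^ (α - 1)) ^ 2 := by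
    filter_upwards [ae_restrict_mem measurableSet_cell] with w hw
    rw [← mul_pow, ← mul_pow]
    exact pow_le_pow_left₀ (norm_nonneg _) (h f hf w (cell_subset_unitSquare hw)) 2
  have hI : Integrable (fun w => ‖zakQuotient f w‖ ^ 2) (volume.restrict cell) := by
    refine (hi.const_mul (C ^ 2 * gaborNorm δ f ^ 2)).mono'
      (hm.norm.pow_const 2).aestronglyMeasurable ?_
    filter_upwards [hb] with w hw
    rwa [Real.norm_of_nonneg (sq_nonneg _)]
  refine ⟨(memLp_two_iff_integrable_sq_norm hm.aestronglyMeasurable).2 hI, ?_⟩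
  refine (integral_mono_ae hI (hi.const_mul _) hb).trans_eq ?_
  rw [integral_const_mul]
  ring

/-! ### The functionals and their continuity -/

theorem continuous_induced_of_norm_le {E F G : Type*} [AddCommGroup E] [SeminormedAddCommGroup F]
    [SeminormedAddCommGroup G] (j : E →+ F) (ψ : E →+ G) (C : ℝ) (h : ∀ x, ‖ψ x‖ ≤ C * ‖j x‖) :
    Continuous[TopologicalSpace.induced j inferInstance, _] ψ := by
  let _ : SeminormedAddCommGroup E := SeminormedAddCommGroup.induced E F j
  exact AddMonoidHomClass.continuous_of_bound ψ C h

/-- The topology induced by `φ` is locally convex, and the bounds make all inclusions continuous for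
it. It thus belongs to the family whose infimum is `gaborHTopology`, which is therefore finer. -/
theorem isContinuousFunctional_of_bound (φ : gaborH →ₗ[ℂ] ℂ)
    (h : ∀ δ : ℝ, 1 < δ → ∃ C : ℝ, ∀ f : gaborH, (f : L2) ∈ gaborSpace δ →
      ‖φ f‖ ≤ C * gaborNorm δ f) : IsContinuousFunctional φ := by
  unfold IsContinuousFunctional
  have hle : gaborHTopology ≤ TopologicalSpace.induced φ inferInstance := by
    refine sInf_le ⟨topologicalAddGroup_induced φ, continuousSMul_induced φ,
      LocallyConvexSpace.induced (φ.restrictScalars ℝ), fun δ hδ => ?_⟩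
    rw [continuous_induced_rng]
    obtain ⟨C, hC⟩ := h δ hδ
    refine continuous_induced_of_norm_le (weightedTransform δ).toAddMonoidHom
      (φ.comp (Submodule.inclusion (gaborSpace_le_gaborH hδ))).toAddMonoidHom C fun f => ?_
    refine (hC (Submodule.inclusion (gaborSpace_le_gaborH hδ) f) f.2).trans_eq ?_
    exact congrArg (C * ·) (norm_weightedTransform δ f).symm
  exact continuous_le_dom hle continuous_induced_dom

theorem integrable_gaborTransform_of_mem {f : L2} (hf : f ∈ gaborH) :
    Integrable (gaborTransform f) := by
  obtain ⟨δ, hδ, h⟩ := hf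
  exact integrable_gaborTransform hδ h

theorem synthesis_gaborTransform_add {f g : L2} (hf : f ∈ gaborH) (hg : g ∈ gaborH) :
    synthesis (gaborTransform (f + g)) =
      synthesis (gaborTransform f) + synthesis (gaborTransform g) := by
  ext x
  rw [Pi.add_apply, synthesis, synthesis, synthesis, ← integral_add
    (integrable_mul_gaborFun (integrable_gaborTransform_of_mem hf) x)
    (integrable_mul_gaborFun (integrable_gaborTransform_of_mem hg) x)]
  simp only [gaborTransform, inner_add_right, add_mul]

theorem synthesis_gaborTransform_smul (c : ℂ) (f : L2) :
    synthesis (gaborTransform (c • f)) = c • synthesis (gaborTransform f) := by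
  ext x
  rw [Pi.smul_apply, synthesis, synthesis, smul_eq_mul, ← integral_const_mul]
  simp only [gaborTransform, inner_smul_right, mul_assoc]

/-- The Zak transform of the continuous representative, as a linear map on `H`. -/
def zakLinear (w : ℝ × ℝ) : gaborH →ₗ[ℂ] ℂ where
  toFun f := zak (synthesis (gaborTransform f)) w
  map_add' f g := by
    obtain ⟨M, -, hW⟩ := exists_isWiener_gaborFun
    rw [Submodule.coe_add, synthesis_gaborTransform_add f.2 g.2]
    exact zak_add (isWiener_synthesis (integrable_gaborTransform_of_mem f.2) hW)
      (isWiener_synthesis (integrable_gaborTransform_of_mem g.2) hW) w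
  map_smul' c f := by
    rw [Submodule.coe_smul, synthesis_gaborTransform_smul, zak_smul]
    rfl

/-- The sharp Poisson functional. -/
def sharpFunctional : gaborH →ₗ[ℂ] ℂ := (1 / (Complex.I * Theta 0)) • zakLinear centre

theorem sharpFunctional_apply (f : gaborH) : sharpFunctional f = sharpCoeff f := rfl

/-- The values of `zakQuotient`, as linear functionals on `H`. -/
def zakQuotientLinear (w : ℝ × ℝ) : gaborH →ₗ[ℂ] ℂ :=
  (zak (gaborFun 0) w)⁻¹ • (zakLinear w - zak (gaborFun sharp) w • sharpFunctional)

theorem zakQuotientLinear_apply (w : ℝ × ℝ) (f : gaborH) :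
    zakQuotientLinear w f = zakQuotient f w := by
  simp only [zakQuotientLinear, LinearMap.smul_apply, LinearMap.sub_apply, smul_eq_mul,
    sharpFunctional_apply, zakQuotient, zakLinear, LinearMap.coe_mk, AddHom.coe_mk]
  ring

theorem memLp_zakQuotient {f : L2} (hf : f ∈ gaborH) :
    MemLp (zakQuotient f) 2 (volume.restrict cell) := by
  obtain ⟨δ, hδ, h⟩ := hf
  obtain ⟨C, -, hC⟩ := exists_integral_norm_sq_zakQuotient_le hδ
  exact (hC f h).1

theorem integrable_conj_character_mul_zakQuotient (n : ℤ × ℤ) {f : L2} (hf : f ∈ gaborH) :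
    Integrable (fun w => starRingEnd ℂ (character n w) * zakQuotient f w)
      (volume.restrict cell) :=
  ((memLp_zakQuotient hf).integrable one_le_two).bdd_mul (c := 1)
    (Complex.continuous_conj.comp (continuous_character n)).aestronglyMeasurable
    (ae_of_all _ fun w => by rw [RCLike.norm_conj, norm_character])

/-- The functionals attached to the lattice points: the Fourier coefficients of the quotient
`Z(f - γ^♯(f) e_♯) / Z e_0`. -/
def latticeFunctional (n : ℤ × ℤ) : gaborH →ₗ[ℂ] ℂ where
  toFun f := cellCoeff (zakQuotient f) n
  map_add' f g := by
    rw [cellCoeff, cellCoeff, cellCoeff, ← integral_add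
      (integrable_conj_character_mul_zakQuotient n f.2)
      (integrable_conj_character_mul_zakQuotient n g.2)]
    simp only [← zakQuotientLinear_apply, map_add, mul_add]
  map_smul' c f := by
    rw [cellCoeff, cellCoeff, RingHom.id_apply, smul_eq_mul, ← integral_const_mul]
    simp only [← zakQuotientLinear_apply, map_smul, smul_eq_mul, mul_left_comm c]

theorem latticeFunctional_apply (n : ℤ × ℤ) (f : gaborH) :
    latticeFunctional n f = cellCoeff (zakQuotient f) n := rfl

theorem exists_hasSum_norm_sq_latticeFunctional {δ : ℝ} (hδ : 1 < δ) :
    ∃ C : ℝ, 0 ≤ C ∧ ∀ f : gaborH, (f : L2) ∈ gaborSpace δ →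
      ∃ S, S ≤ C * gaborNorm δ f ^ 2 ∧ HasSum (fun n => ‖latticeFunctional n f‖ ^ 2) S := by
  obtain ⟨C, hC, h⟩ := exists_integral_norm_sq_zakQuotient_le hδ
  refine ⟨C, hC, fun f hf => ⟨_, ?_, (hasSum_fourier_cell (h f hf).1).2⟩⟩
  rw [norm_toLp_sq]
  exact (h f hf).2

theorem isContinuousFunctional_latticeFunctional (n : ℤ × ℤ) :
    IsContinuousFunctional (latticeFunctional n) := by
  refine isContinuousFunctional_of_bound _ fun δ hδ => ?_
  obtain ⟨C, hC, h⟩ := exists_hasSum_norm_sq_latticeFunctional hδ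
  refine ⟨√C, fun f hf => ?_⟩
  obtain ⟨S, hS, hs⟩ := h f hf
  have h1 : ‖latticeFunctional n f‖ ^ 2 ≤ C * gaborNorm δ f ^ 2 :=
    (le_hasSum hs n fun _ _ => sq_nonneg _).trans hS
  refine le_of_sq_le_sq ?_ (mul_nonneg (Real.sqrt_nonneg _) (gaborNorm_nonneg δ f))
  rwa [mul_pow, Real.sq_sqrt hC]

theorem isContinuousFunctional_sharpFunctional : IsContinuousFunctional sharpFunctional := by
  refine isContinuousFunctional_of_bound _ fun δ hδ => ?_
  obtain ⟨C, -, h⟩ := exists_norm_sharpCoeff_le hδ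
  exact ⟨C, fun f hf => h f hf⟩

/-- The continuous representative is the synthesis integral. At the centre the Zak phases `exp(-π i
q)` are the signs `(-1)^q`. -/
theorem isSharpPoisson_sharpFunctional (f : gaborH) : IsSharpPoisson f (sharpFunctional f) := by
  obtain ⟨M, -, hW⟩ := exists_isWiener_gaborFun
  have hA := integrable_gaborTransform_of_mem f.2
  have hS := isWiener_synthesis hA hW
  refine ⟨synthesis (gaborTransform f), hS.continuous, ae_eq_synthesis f hA, ?_⟩
  have h := (hS.summable_zakTerm centre).hasSum.mul_left (1 / (Complex.I * Theta 0))
  convert! h using 1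
  ext q
  have e : Complex.exp (-(2 * Real.pi * Complex.I * q * ((1 / 2 : ℝ) : ℂ))) = (-1) ^ q := by
    rw [show (-(2 * Real.pi * Complex.I * q * ((1 / 2 : ℝ) : ℂ)) : ℂ) =
      q * (-(Real.pi * Complex.I)) by push_cast; ring, Complex.exp_int_mul, Complex.exp_neg,
      Complex.exp_pi_mul_I]
    norm_num
  simp only [zakTerm, centre]
  rw [e, add_comm (q : ℝ)]
  ring

/-! ### Convergence of the expansion -/

/-- The expansion of `f - γ^♯(f) e_♯` in the Gabor functions of the lattice. -/
theorem hasSum_latticeFunctional (f : gaborH) :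
    HasSum (fun n => latticeFunctional n f • gaborState (latticePoint n))
      ((f : L2) - sharpFunctional f • gaborState sharp) := by
  obtain ⟨M, hM, hW⟩ := exists_isWiener_gaborFun
  have hA := integrable_gaborTransform_of_mem f.2
  have hS := isWiener_synthesis hA hW
  have hF := memLp_zakQuotient f.2
  have hc : ∀ n : ℤ × ℤ, ∃ N, IsWiener ((-latticeFunctional n f) • gaborFun (latticePoint n)) N :=
    fun n => ⟨_, (hW _).smul _⟩
  -- The Zak transform of the remainder is `Z e_0` times the remainder of the Fourier series of the
  -- quotient, and `|Z e_0| ≤ M`.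
  have key : ∀ s : Finset (ℤ × ℤ),
      ‖(f : L2) - sharpFunctional f • gaborState sharp -
        ∑ n ∈ s, latticeFunctional n f • gaborState (latticePoint n)‖ ^ 2 ≤
      M ^ 2 * ∫ w in cell,
        ‖zakQuotient f w - ∑ n ∈ s, cellCoeff (zakQuotient f) n * character n w‖ ^ 2 := by
    intro s
    obtain ⟨⟨N, hN⟩, hz⟩ := exists_isWiener_sum s hc
    have hsh := (hW sharp).smul (-sharpFunctional f)
    -- A pointwise representative of the remainder, built as a finite sum of functions satisfying
    -- `IsWiener`, so that the isometry applies to it.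
    set g : ℝ → ℂ := synthesis (gaborTransform f) + (-sharpFunctional f) • gaborFun sharp +
      ∑ n ∈ s, (-latticeFunctional n f) • gaborFun (latticePoint n) with hg
    have hgW := (hS.add hsh).add hN
    have hst : ∀ l, gaborState l =ᵐ[volume] gaborFun l := fun l => (memLp_gaborFun l).coeFn_toLp
    have hmem : MemLp (synthesis (gaborTransform f)) 2 volume :=
      (Lp.memLp (f : L2)).ae_eq (ae_eq_synthesis f hA)
    have m2 : MemLp ((-sharpFunctional f) • gaborFun sharp) 2 volume :=
      (memLp_gaborFun sharp).const_smul _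
    have m3 : MemLp (∑ n ∈ s, (-latticeFunctional n f) • gaborFun (latticePoint n)) 2 volume :=
      memLp_finsetSum' s fun n _ => (memLp_gaborFun _).const_smul _
    have hgm : MemLp g 2 volume := (hmem.add m2).add m3
    have hL : (f : L2) - sharpFunctional f • gaborState sharp -
        ∑ n ∈ s, latticeFunctional n f • gaborState (latticePoint n) = hgm.toLp g := by
      have e3 : m3.toLp _ = ∑ n ∈ s, (-latticeFunctional n f) • gaborState (latticePoint n) := by
        refine Lp.ext ((MemLp.coeFn_toLp m3).trans ?_)
        refine EventuallyEq.trans ?_ (Lp.coeFn_finsetSum _ _).symm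
        have : ∀ n : ℤ × ℤ, ((-latticeFunctional n f) • gaborState (latticePoint n) : L2)
            =ᵐ[volume] (-latticeFunctional n f) • gaborFun (latticePoint n) := fun n => by
          filter_upwards [Lp.coeFn_smul (-latticeFunctional n f) (gaborState (latticePoint n)),
            hst (latticePoint n)] with x h1 h2
          rw [h1, Pi.smul_apply, Pi.smul_apply, h2]
        filter_upwards [ae_all_iff.2 this] with x hx
        simp only [Finset.sum_apply, hx]
      have e1 : hmem.toLp _ = (f : L2) :=
        Lp.ext ((MemLp.coeFn_toLp hmem).trans (ae_eq_synthesis f hA).symm)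
      have e2 : m2.toLp _ = (-sharpFunctional f) • gaborState sharp :=
        MemLp.toLp_const_smul _ (memLp_gaborFun sharp)
      rw [show hgm.toLp g = hmem.toLp _ + m2.toLp _ + m3.toLp _ from rfl, e1, e2, e3]
      simp only [neg_smul, Finset.sum_neg_distrib, sub_eq_add_neg]
    rw [hL, norm_toLp_sq, ← hgW.integral_norm_sq_zak hgm, ← integral_const_mul]
    have hzak : ∀ w ∈ unitSquare, zak g w = zak (gaborFun 0) w *
        (zakQuotient f w - ∑ n ∈ s, cellCoeff (zakQuotient f) n * character n w) := by
      intro w hw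
      rw [hg, zak_add (hS.add hsh) hN, zak_add hS hsh, hz, zak_smul, sharpFunctional_apply]
      simp only [zak_smul, zak_gaborFun_latticePoint, latticeFunctional_apply, neg_mul,
        Finset.sum_neg_distrib]
      have h1 := zakQuotient_mul f hw
      rw [mul_sub, Finset.mul_sum, mul_comm (zak (gaborFun 0) w) (zakQuotient _ w), h1,
        sub_eq_add_neg, sub_eq_add_neg]
      congr 2
      exact Finset.sum_congr rfl fun n _ => by ring
    have hdiff : MemLp (fun w => zakQuotient f w -
        ∑ n ∈ s, cellCoeff (zakQuotient f) n * character n w) 2 (volume.restrict cell) :=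
      hF.sub (memLp_finsetSum s fun n _ => (memLp_character n).const_mul _)
    refine integral_mono_ae ((hgW.memLp_zak 2).integrable_norm_pow (by norm_num))
      ((hdiff.integrable_norm_pow (by norm_num)).const_mul _) ?_
    filter_upwards [ae_restrict_mem measurableSet_cell] with w hw
    rw [hzak w (cell_subset_unitSquare hw), norm_mul, mul_pow]
    have := (hW 0).norm_zak_le w
    gcongr
  have ht := (tendsto_integral_norm_sq_sub_fourier_sum hF).const_mul (M ^ 2)
  rw [mul_zero] at ht
  have h0 := squeeze_zero (fun s => sq_nonneg _) key ht
  have h1 := h0.sqrt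
  simp only [Real.sqrt_sq (norm_nonneg _), Real.sqrt_zero] at h1
  have h2 := tendsto_zero_iff_norm_tendsto_zero.2 h1
  have h3 := (tendsto_const_nhds
    (x := (f : L2) - sharpFunctional f • gaborState sharp)).sub h2
  simp only [sub_sub_cancel, sub_zero] at h3
  exact h3

/-! ### Reindexing by the relaxed lattice -/

/-- The indexing of the relaxed lattice by `ℤ × ℤ` and one more point. -/
def relaxedPoint : (ℤ × ℤ) ⊕ Unit → relaxedLattice
  | Sum.inl n => ⟨latticePoint n, Or.inl ⟨n, rfl⟩⟩
  | Sum.inr _ => ⟨sharp, sharp_mem_relaxedLattice⟩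

theorem latticePoint_ne_sharp (n : ℤ × ℤ) : latticePoint n ≠ sharp := by
  intro h
  have h1 : (n.1 : ℝ) = 1 / 2 := congrArg Prod.fst h
  have h2 : (2 * n.1 : ℤ) = 1 := by
    have : (2 * n.1 : ℝ) = 1 := by rw [h1]; norm_num
    exact_mod_cast this
  omega

theorem latticePoint_injective : Function.Injective latticePoint := by
  intro m n h
  have h1 : (m.1 : ℝ) = n.1 := congrArg Prod.fst h
  have h2 : (m.2 : ℝ) = n.2 := congrArg Prod.snd h
  exact Prod.ext (by exact_mod_cast h1) (by exact_mod_cast h2)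

theorem bijective_relaxedPoint : Function.Bijective relaxedPoint := by
  constructor
  · rintro (m | ⟨⟩) (n | ⟨⟩) h
    · rw [latticePoint_injective (congrArg Subtype.val h)]
    · exact (latticePoint_ne_sharp m (congrArg Subtype.val h)).elim
    · exact (latticePoint_ne_sharp n (congrArg Subtype.val h).symm).elim
    · rfl
  · rintro ⟨l, ⟨n, rfl⟩ | hl⟩
    · exact ⟨Sum.inl n, rfl⟩
    · exact ⟨Sum.inr (), Subtype.ext hl.symm⟩

/-- The bijection of `(ℤ × ℤ) ⊕ Unit` with the relaxed lattice. -/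
def relaxedEquiv : (ℤ × ℤ) ⊕ Unit ≃ relaxedLattice := Equiv.ofBijective _ bijective_relaxedPoint

/-- The coefficient functionals of the relaxed Gabor expansion. -/
def relaxedFunctional (l : relaxedLattice) : gaborH →ₗ[ℂ] ℂ :=
  Sum.elim latticeFunctional (fun _ => sharpFunctional) (relaxedEquiv.symm l)

theorem relaxedFunctional_relaxedEquiv (i : (ℤ × ℤ) ⊕ Unit) :
    relaxedFunctional (relaxedEquiv i) =
      Sum.elim latticeFunctional (fun _ => sharpFunctional) i := by
  rw [relaxedFunctional, Equiv.symm_apply_apply]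

theorem relaxedFunctional_sharp :
    relaxedFunctional ⟨sharp, sharp_mem_relaxedLattice⟩ = sharpFunctional :=
  relaxedFunctional_relaxedEquiv (Sum.inr ())

theorem isContinuousFunctional_relaxedFunctional (l : relaxedLattice) :
    IsContinuousFunctional (relaxedFunctional l) := by
  obtain ⟨i, rfl⟩ := relaxedEquiv.surjective l
  rw [relaxedFunctional_relaxedEquiv]
  rcases i with n | _
  · exact isContinuousFunctional_latticeFunctional n
  · exact isContinuousFunctional_sharpFunctional

theorem hasSum_relaxedFunctional (f : gaborH) :
    HasSum (fun l : relaxedLattice => relaxedFunctional l f • gaborState (l : Phase)) (f : L2) := by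
  rw [← relaxedEquiv.hasSum_iff]
  have h2 := hasSum_unique fun _ : Unit => sharpFunctional f • gaborState sharp
  rw [← sub_add_cancel (f : L2) (sharpFunctional f • gaborState sharp)]
  refine HasSum.sum ?_ ?_
  · refine (hasSum_latticeFunctional f).congr_fun fun n => ?_
    simp only [Function.comp_apply, relaxedFunctional_relaxedEquiv, Sum.elim_inl]
    rfl
  · refine h2.congr_fun fun n => ?_
    simp only [Function.comp_apply, relaxedFunctional_relaxedEquiv, Sum.elim_inr]
    rfl

theorem exists_summable_norm_sq_relaxedFunctional {δ : ℝ} (hδ : 1 < δ) :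
    ∃ C : ℝ, ∀ f : gaborH, (f : L2) ∈ gaborSpace δ →
      Summable (fun l : relaxedLattice => ‖relaxedFunctional l f‖ ^ 2) ∧
      ∑' l : relaxedLattice, ‖relaxedFunctional l f‖ ^ 2 ≤ C * gaborNorm δ f ^ 2 := by
  obtain ⟨C, -, hC⟩ := exists_hasSum_norm_sq_latticeFunctional hδ
  obtain ⟨D, -, hD⟩ := exists_norm_sharpCoeff_le hδ
  refine ⟨C + D ^ 2, fun f hf => ?_⟩
  obtain ⟨S, hS, h1⟩ := hC f hf
  have h2 := hasSum_unique fun _ : Unit => ‖sharpFunctional f‖ ^ 2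
  have h : HasSum (fun l : relaxedLattice => ‖relaxedFunctional l f‖ ^ 2)
      (S + ‖sharpFunctional f‖ ^ 2) := by
    rw [← relaxedEquiv.hasSum_iff]
    refine HasSum.sum (h1.congr_fun fun n => ?_) (h2.congr_fun fun n => ?_)
    · simp only [Function.comp_apply, relaxedFunctional_relaxedEquiv, Sum.elim_inl]
    · simp only [Function.comp_apply, relaxedFunctional_relaxedEquiv, Sum.elim_inr]
  refine ⟨h.summable, h.tsum_eq.trans_le ?_⟩
  have h3 : ‖sharpFunctional f‖ ^ 2 ≤ (D * gaborNorm δ f) ^ 2 :=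
    pow_le_pow_left₀ (norm_nonneg _) (hD f hf) 2
  rw [mul_pow] at h3
  linarith

end RelaxedGabor

end

theorem mainTheorem1 :
    ∃ γ : RelaxedGabor.relaxedLattice → (RelaxedGabor.gaborH →ₗ[ℂ] ℂ),
      (∀ l, RelaxedGabor.IsContinuousFunctional (γ l)) ∧
      (∀ f : RelaxedGabor.gaborH,
        RelaxedGabor.IsSharpPoisson f
          (γ ⟨RelaxedGabor.sharp, RelaxedGabor.sharp_mem_relaxedLattice⟩ f)) ∧
      (∀ f : RelaxedGabor.gaborH,
        HasSum (fun l : RelaxedGabor.relaxedLattice =>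
          γ l f • RelaxedGabor.gaborState (l : RelaxedGabor.Phase)) (f : RelaxedGabor.L2)) ∧
      (∀ δ : ℝ, 1 < δ → ∃ C : ℝ, ∀ f : RelaxedGabor.gaborH,
        (f : RelaxedGabor.L2) ∈ RelaxedGabor.gaborSpace δ →
          Summable (fun l : RelaxedGabor.relaxedLattice => ‖γ l f‖ ^ 2) ∧
          ∑' l : RelaxedGabor.relaxedLattice, ‖γ l f‖ ^ 2 ≤
            C * RelaxedGabor.gaborNorm δ f ^ 2) :=
  ⟨RelaxedGabor.relaxedFunctional, RelaxedGabor.isContinuousFunctional_relaxedFunctional,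
    fun f => RelaxedGabor.relaxedFunctional_sharp ▸ RelaxedGabor.isSharpPoisson_sharpFunctional f,
    RelaxedGabor.hasSum_relaxedFunctional,
    fun _ hδ => RelaxedGabor.exists_summable_norm_sq_relaxedFunctional hδ⟩
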